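/- For complex parameters let $${}_pF_q\biggl[\begin{matrix} a_1,\dots,a_p\\ b_1,\dots,b_q\end{matrix};z\biggr]=\sum_{k=0}^\infty\frac{(a_1)_k\cdots(a_p)_k}{(b_1)_k\cdots(b_q)_k}\,\frac{z^k}{k!},\qquad (a)_k=a(a+1)\cdots(a+k-1),$$ where no $b_i$ is in $\mathbb Z_{\le0}=\{0,-1,-2,\dots\}$ and the sum is the limit of the partial sums. (i) Let $n,c,d\in\mathbb C$ be such that none of the lower parameters of the two series below, nor $4n+3-c-d$, is in $\mathbb Z_{\le0}$, and such that either $\operatorname{Re}(5n+4-2c-2d)>0$ and $\operatorname{Re}(3n+2-c-d)>0$, or at least one of $c,d$ is in $\mathbb Z_{\le0}$ (in which case both series terminate). Then both series converge, and $$ {}_6F_5\biggl[\begin{matrix} 3n+1, \, \frac{3n}2+\frac32, \, n+\frac12, \, n+1, \, c, \, d \\ \frac{3n}2+\frac12, \, 2n+\frac32, \, 2n+1, \, 3n+2-c, \, 3n+2-d \end{matrix}\,; -1\biggr] $$ $$ =\frac{\Gamma(4n+3)\,\Gamma(3n+2-c)\,\Gamma(3n+2-d)\,\Gamma(4n+3-c-d)}{\Gamma(3n+2)\,\Gamma(4n+3-c)\,\Gamma(4n+3-d)\,\Gamma(3n+2-c-d)}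 \;{}_6F_5\biggl[\begin{matrix} 2n+1, \, n+\frac32, \, \frac c2, \, \frac c2+\frac12, \, \frac d2, \, \frac d2+\frac12 \\ n+\frac12, \, 2n+2-\frac c2, \, 2n+\frac32-\frac c2, \, 2n+2-\frac d2, \, 2n+\frac32-\frac d2 \end{matrix}; 1\biggr], $$ where $1/\Gamma$ is read as $0$ at the poles of $\Gamma$. (ii) (The case $c=d=n+\frac12$.) For every integer $n\ge0$, the following two families of approximations to Catalan's constant coincide: both series converge absolutely and $$ \sum_{t=0}^\infty(2t+n+1)\frac{n!\prod_{j=1}^n(t+1-j)\prod_{j=1}^n(t+n+j)}{\prod_{j=0}^n(t+j+\frac12)^3}\,(-1)^{n+t} =2^{2(n+1)}\sum_{t=1}^\infty(2t-1)\frac{(2n+1)!\prod_{j=0}^{2n-1}(t-n+j)}{\prod_{j=0}^{2n+1}(2t-n-\frac32+j)^2}. $$ -/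

import Mathlib

open Filter Topology

noncomputable section

/-- The `k`-th term `(a₁)ₖ ⋯ (aₚ)ₖ / ((b₁)ₖ ⋯ (b_q)ₖ) * z ^ k / k!` of the generalized
hypergeometric series with upper parameters `as`, lower parameters `bs` and argument `z`. -/
def hypTerm (as bs : List ℂ) (z : ℂ) (k : ℕ) : ℂ :=
  (as.map fun a => (ascPochhammer ℂ k).eval a).prod /
    (bs.map fun b => (ascPochhammer ℂ k).eval b).prod * (z ^ k / (k.factorial : ℂ))

/-- The generalized hypergeometric series converges, with sum `s`. Convergence is that of the
partial sums, since on the circle `‖z‖ = 1` it may be conditional. -/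
def HasHypSum (as bs : List ℂ) (z s : ℂ) : Prop :=
  Tendsto (fun N : ℕ => ∑ k ∈ Finset.range N, hypTerm as bs z k) atTop (𝓝 s)

/-- `x` is one of `0, -1, -2, …`. -/
def IsNonposInt (x : ℂ) : Prop :=
  ∃ m : ℕ, x = -(m : ℂ)

/-- The upper parameters of the series at `-1`. -/
def upperL (n c d : ℂ) : List ℂ :=
  [3 * n + 1, 3 * n / 2 + 3 / 2, n + 1 / 2, n + 1, c, d]

/-- The lower parameters of the series at `-1`. -/
def lowerL (n c d : ℂ) : List ℂ :=
  [3 * n / 2 + 1 / 2, 2 * n + 3 / 2, 2 * n + 1, 3 * n + 2 - c, 3 * n + 2 - d]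

/-- The upper parameters of the series at `1`. -/
def upperR (n c d : ℂ) : List ℂ :=
  [2 * n + 1, n + 3 / 2, c / 2, c / 2 + 1 / 2, d / 2, d / 2 + 1 / 2]

/-- The lower parameters of the series at `1`. -/
def lowerR (n c d : ℂ) : List ℂ :=
  [n + 1 / 2, 2 * n + 2 - c / 2, 2 * n + 3 / 2 - c / 2, 2 * n + 2 - d / 2, 2 * n + 3 / 2 - d / 2]

/-- The summand, at `t = 0, 1, 2, …`, of the first family of approximations to Catalan's
constant. -/
def catTerm (n t : ℕ) : ℝ :=
  (2 * t + n + 1) *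
    ((n.factorial * (∏ j ∈ Finset.Icc 1 n, ((t : ℝ) + 1 - j)) *
        ∏ j ∈ Finset.Icc 1 n, ((t : ℝ) + n + j)) /
      ∏ j ∈ Finset.range (n + 1), ((t : ℝ) + j + 1 / 2) ^ 3) * (-1) ^ (n + t)

/-- The summand, at `t = 1, 2, 3, …`, of the second family of approximations to Catalan's constant
(including the factor `2 ^ (2 * (n + 1))` in front of the sum). -/
def catTerm' (n t : ℕ) : ℝ :=
  2 ^ (2 * (n + 1)) *
    ((2 * t - 1) *
      (((2 * n + 1).factorial * ∏ j ∈ Finset.range (2 * n), ((t : ℝ) - n + j)) /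
        ∏ j ∈ Finset.range (2 * n + 2), (2 * (t : ℝ) - n - 3 / 2 + j) ^ 2))

end

/-!
Call `(α, β)` a Bailey pair relative to `a` when `β m = ∑ r ≤ m, α r / ((m - r)! Γ(1 + a + m + r))`.
Bailey's lemma, the limit `N → ∞` of a Pfaff–Saalschütz summation, turns the well-poised sum
`∑ (c)_r (d)_r α r / (Γ(1 + a - c + r) Γ(1 + a - d + r))` into
`∑ (c)_m (d)_m β m / Γ(1 + a - c - d)`.
The series at `-1` comes in this way from the very-well-poised pair relative to `3n + 1`, and the
series at `1` from a pair relative to `4n + 2` whose `α` is supported on the even integers. Up to a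
constant factor both pairs have the same `β`, so both series are multiples of one series in `c, d`.

The passage to the limit is dominated when `0 ≤ Re (a - c - d)`. Both sides are analytic in `c`
wherever they converge, which gives the general case; the conditionally convergent alternating
series is first replaced by the absolutely convergent series of its averaged terms.

The second part is the case `c = d = n + 1/2`: each family is a constant times the corresponding
series, read from its first nonvanishing term on.
-/

noncomputable section

open Complex Finset

section Pochhammer

/-- The Pochhammer symbol `(x)ₖ`, a shorthand for evaluating Mathlib's `ascPochhammer`. -/
def poch {R : Type*} [Semiring R] (x : R) (k : ℕ) : R := (ascPochhammer R k).eval x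

@[simp] lemma poch_zero {R : Type*} [Semiring R] (x : R) : poch x 0 = 1 := by simp [poch]

lemma poch_one {R : Type*} [Semiring R] (k : ℕ) : poch (1 : R) k = k.factorial :=
  ascPochhammer_eval_one R k

lemma poch_succ {R : Type*} [Semiring R] (x : R) (k : ℕ) :
    poch x (k + 1) = poch x k * (x + k) :=
  ascPochhammer_succ_eval k x

variable {R : Type*} [CommRing R]

lemma poch_add (x : R) (m k : ℕ) : poch x (m + k) = poch x m * poch (x + m) k := by
  simp [poch, ← ascPochhammer_mul, Polynomial.eval_comp]

lemma poch_succ_left (x : R) (k : ℕ) : poch x (k + 1) = x * poch (x + 1) k := by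
  simp [poch, ascPochhammer_succ_left, Polynomial.eval_comp]

lemma prod_range_add_eq_poch (x : R) (m : ℕ) : ∏ j ∈ range m, (x + j) = poch x m := by
  induction m with
  | zero => simp
  | succ m ih => rw [prod_range_succ, ih, poch_succ]

end Pochhammer

section Saalschutz

variable {R : Type*} [CommRing R] (A B C : R)

/-- The summand of the Pfaff–Saalschütz sum without its binomial coefficient, so that the sum runs
over `j + l = n`. -/
def saalschutzTerm (j l : ℕ) : R :=
  poch A j * poch B j * poch (C + j) l * poch (C - A - B) l

/-- The certificate by which the recurrence in `n` of the Pfaff–Saalschütz sum telescopes. -/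
def saalschutzCert (n j : ℕ) : R :=
  n.choose j * j * (poch A j * poch B j * poch (C + j) (n - j) * poch (C - A - B) (n - j + 1))

lemma saalschutzTerm_recurrence {n j : ℕ} (hj : j ≤ n) :
    n.choose j * saalschutzTerm A B C j (n + 1 - j) +
        n.choose j * saalschutzTerm A B C (j + 1) (n - j) =
      (C - A + n) * (C - B + n) * (n.choose j * saalschutzTerm A B C j (n - j)) +
        (saalschutzCert A B C n (j + 1) - saalschutzCert A B C n j) := by
  obtain ⟨l, rfl⟩ := Nat.exists_eq_add_of_le hj
  rw [saalschutzCert, saalschutzCert, add_assoc j l 1, Nat.add_sub_cancel_left,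
    Nat.add_sub_cancel_left]
  rcases l with _ | l
  · simp only [saalschutzTerm, poch_succ, poch_zero, zero_add, add_zero, Nat.choose_self,
      Nat.choose_succ_self, Nat.cast_zero, Nat.cast_one]
    push_cast
    ring
  have choose_succ : ((j + (l + 1)).choose (j + 1) : R) * ((j + 1 : ℕ) : R) =
      (j + (l + 1)).choose j * ((l + 1 : ℕ) : R) := by
    have h := Nat.choose_succ_right_eq (j + (l + 1)) j
    rw [Nat.add_sub_cancel_left] at h
    exact_mod_cast congrArg (Nat.cast : ℕ → R) h
  have shift (k : ℕ) : poch (C + j) (k + 1) = (C + j) * poch (C + (j + 1 : ℕ)) k := by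
    rw [poch_succ_left]; push_cast; ring_nf
  rw [choose_succ, show j + (l + 1) - (j + 1) = l by omega]
  simp only [saalschutzTerm, shift, poch_succ]
  push_cast
  ring

theorem pfaff_saalschutz (n : ℕ) :
    ∑ p ∈ antidiagonal n, n.choose p.1 * saalschutzTerm A B C p.1 p.2 =
      poch (C - A) n * poch (C - B) n := by
  simp only [Nat.sum_antidiagonal_eq_sum_range_succ_mk]
  induction n with
  | zero => simp [saalschutzTerm]
  | succ n ih =>
    have boundary : saalschutzCert A B C n (n + 1) - saalschutzCert A B C n 0 = 0 := by
      simp [saalschutzCert]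
    rw [sum_choose_succ_mul, ← sum_add_distrib,
      sum_congr rfl fun j hj =>
        saalschutzTerm_recurrence A B C (mem_range_succ_iff.mp hj),
      sum_add_distrib, ← mul_sum, ih, sum_range_sub, boundary]
    simp only [poch_succ]
    ring

end Saalschutz

section BaileyPair

lemma inv_Gamma_eq_mul (z : ℂ) : (Gamma z)⁻¹ = z * (Gamma (z + 1))⁻¹ :=
  one_div_Gamma_eq_self_mul_one_div_Gamma_add_one z

lemma inv_Gamma_eq_poch_mul (z : ℂ) (k : ℕ) :
    (Gamma z)⁻¹ = poch z k * (Gamma (z + k))⁻¹ := by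
  induction k with
  | zero => simp
  | succ k ih => rw [ih, poch_succ, inv_Gamma_eq_mul (z + k), mul_assoc]; push_cast; ring_nf

lemma natCast_factorial_ne_zero (k : ℕ) : (k.factorial : ℂ) ≠ 0 :=
  Nat.cast_ne_zero.mpr k.factorial_ne_zero

lemma sum_antidiagonal_fst_eq_sum_antidiagonal_snd {M : Type*} [AddCommMonoid M]
    (f : ℕ → ℕ → ℕ → M) (N : ℕ) :
    ∑ p ∈ antidiagonal N, ∑ q ∈ antidiagonal p.1, f q.1 q.2 p.2 =
      ∑ p ∈ antidiagonal N, ∑ q ∈ antidiagonal p.2, f p.1 q.1 q.2 := by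
  rw [sum_sigma', sum_sigma']
  refine sum_nbij' (fun x => ⟨(x.2.1, x.2.2 + x.1.2), (x.2.2, x.1.2)⟩)
    (fun x => ⟨(x.1.1 + x.2.1, x.2.2), (x.1.1, x.2.1)⟩) ?_ ?_ ?_ ?_ fun _ _ => rfl
  all_goals
    rintro ⟨⟨_, _⟩, ⟨_, _⟩⟩ h
    simp only [mem_sigma, HasAntidiagonal.mem_antidiagonal] at h ⊢
    grind

/-- `(α, β)` is a Bailey pair relative to `a` (in the limit `q → 1`), written as a sum over
`r + j = m`. It is normalised with `1 / Γ` instead of a Pochhammer symbol in the denominator, so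
that `1 + a` may be a pole of `Γ`. -/
def IsBaileyPair (a : ℂ) (α β : ℕ → ℂ) : Prop :=
  ∀ m, β m = ∑ p ∈ antidiagonal m,
    α p.1 / (p.2.factorial : ℂ) * (Gamma (1 + a + 2 * p.1 + p.2))⁻¹

/-- Finite Bailey lemma: one interchange of summations and the Pfaff–Saalschütz sum. -/
theorem IsBaileyPair.sum_eq {a : ℂ} {α β : ℕ → ℂ} (h : IsBaileyPair a α β) (c d : ℂ) (N : ℕ) :
    ∑ p ∈ antidiagonal N, poch c p.1 * poch d p.1 *
        (poch (1 + a - c - d) p.2 / (p.2.factorial : ℂ)) * β p.1 =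
      ∑ p ∈ antidiagonal N, α p.1 * poch c p.1 * poch d p.1 * poch (1 + a - c + p.1) p.2 *
        poch (1 + a - d + p.1) p.2 / (p.2.factorial : ℂ) *
        (Gamma (1 + a + 2 * p.1 + p.2))⁻¹ := by
  have expand (p : ℕ × ℕ) : poch c p.1 * poch d p.1 *
      (poch (1 + a - c - d) p.2 / (p.2.factorial : ℂ)) * β p.1 =
      ∑ q ∈ antidiagonal p.1, poch c (q.1 + q.2) * poch d (q.1 + q.2) *
        (poch (1 + a - c - d) p.2 / (p.2.factorial : ℂ)) *
        (α q.1 / (q.2.factorial : ℂ) * (Gamma (1 + a + 2 * q.1 + q.2))⁻¹) := by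
    rw [h, mul_sum]
    exact sum_congr rfl fun q hq => by rw [HasAntidiagonal.mem_antidiagonal.mp hq]
  simp only [expand]
  rw [sum_antidiagonal_fst_eq_sum_antidiagonal_snd fun r j l => poch c (r + j) * poch d (r + j) *
    (poch (1 + a - c - d) l / (l.factorial : ℂ)) *
    (α r / (j.factorial : ℂ) * (Gamma (1 + a + 2 * r + j))⁻¹)]
  refine sum_congr rfl fun ⟨r, i⟩ _ => ?_
  have saalschutz := pfaff_saalschutz (c + r) (d + r) (1 + a + 2 * r) i
  rw [show 1 + a + 2 * r - (c + r) = 1 + a - c + r by ring,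
    show 1 + a + 2 * r - (d + r) = 1 + a - d + r by ring] at saalschutz
  rw [mul_assoc (α r * poch c r * poch d r), ← saalschutz, mul_sum, sum_div, sum_mul]
  refine sum_congr rfl fun ⟨j, l⟩ hjl => ?_
  obtain rfl := HasAntidiagonal.mem_antidiagonal.mp hjl
  rw [saalschutzTerm, inv_Gamma_eq_poch_mul (1 + a + 2 * r + j) l, poch_add c, poch_add d,
    Nat.cast_add_choose, show 1 + a + 2 * r - (c + r) - (d + r) = 1 + a - c - d by ring,
    Nat.cast_add, ← add_assoc]
  have := natCast_factorial_ne_zero (j + l)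
  field_simp

/-- The certificate by which the sum in the unit Bailey pair telescopes. -/
def unitPairCert (a : ℂ) (m r : ℕ) : ℂ :=
  -((-1) ^ r * (r * m.choose r / m) * poch a r * (Gamma (a + m + r))⁻¹)

lemma unitPairCert_succ_sub (a : ℂ) {m r : ℕ} (hm : m ≠ 0) (hr : r ≤ m) :
    unitPairCert a m (r + 1) - unitPairCert a m r =
      m.choose r * ((-1) ^ r * (a + 2 * r) * poch a r) * (Gamma (1 + a + m + r))⁻¹ := by
  have choose_succ : ((r + 1 : ℕ) : ℂ) * m.choose (r + 1) = m.choose r * (m - r) := by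
    rw [← Nat.cast_sub hr, mul_comm]
    exact_mod_cast Nat.choose_succ_right_eq m r
  have hm' : (m : ℂ) ≠ 0 := Nat.cast_ne_zero.mpr hm
  rw [unitPairCert, unitPairCert, choose_succ, inv_Gamma_eq_mul (a + m + r), poch_succ,
    show a + m + (r + 1 : ℕ) = 1 + a + m + r by push_cast; ring,
    show a + m + r + 1 = 1 + a + m + r by ring]
  field_simp
  ring

theorem isBaileyPair_unit (a : ℂ) :
    IsBaileyPair a (fun r => (-1) ^ r * (a + 2 * r) * poch a r / (r.factorial : ℂ))
      (fun m => if m = 0 then a * (Gamma (1 + a))⁻¹ else 0) := by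
  intro m
  rcases eq_or_ne m 0 with rfl | hm
  · simp
  have telescope : ∑ r ∈ range (m + 1), m.choose r * ((-1) ^ r * (a + 2 * r) * poch a r) *
      (Gamma (1 + a + m + r))⁻¹ = 0 := by
    rw [← sum_congr rfl fun r hr => unitPairCert_succ_sub a hm (mem_range_succ_iff.mp hr),
      sum_range_sub]
    simp [unitPairCert]
  beta_reduce
  rw [if_neg hm, ← zero_div (m.factorial : ℂ), ← telescope,
    ← Nat.sum_antidiagonal_eq_sum_range_succ_mk (fun p : ℕ × ℕ => m.choose p.1 *
      ((-1) ^ p.1 * (a + 2 * p.1) * poch a p.1) * (Gamma (1 + a + m + p.1))⁻¹), sum_div]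
  refine sum_congr rfl fun ⟨r, j⟩ hrj => ?_
  obtain rfl := HasAntidiagonal.mem_antidiagonal.mp hrj
  rw [Nat.cast_add_choose,
    show 1 + a + (r + j : ℕ) + r = 1 + a + 2 * r + j by push_cast; ring]
  have := natCast_factorial_ne_zero (r + j)
  field_simp

/-- This comes from the unit pair by the finite form of Bailey's lemma. -/
theorem isBaileyPair_veryWellPoised (a b b' : ℂ) (hb : ∀ k, poch (1 + a - b) k ≠ 0)
    (hb' : ∀ k, poch (1 + a - b') k ≠ 0) :
    IsBaileyPair a
      (fun r => (-1) ^ r * ((a + 2 * r) * (poch a r / (r.factorial : ℂ)) *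
        (poch b r / poch (1 + a - b) r) * (poch b' r / poch (1 + a - b') r)))
      (fun m => a * (Gamma (1 + a))⁻¹ * (poch (1 + a - b - b') m /
        (poch (1 + a - b) m * poch (1 + a - b') m * (m.factorial : ℂ)))) := by
  intro m
  have unit := (isBaileyPair_unit a).sum_eq b b' m
  simp only [mul_ite, mul_zero] at unit
  rw [Nat.sum_antidiagonal_eq_sum_range_succ_mk,
    sum_ite_eq_of_mem' _ _ _ (mem_range.mpr m.succ_pos)] at unit
  have factor : a * (Gamma (1 + a))⁻¹ * (poch (1 + a - b - b') m /
      (poch (1 + a - b) m * poch (1 + a - b') m * (m.factorial : ℂ))) =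
      poch b 0 * poch b' 0 * (poch (1 + a - b - b') (m - 0) / ((m - 0).factorial : ℂ)) *
        (a * (Gamma (1 + a))⁻¹) / (poch (1 + a - b) m * poch (1 + a - b') m) := by
    simp only [poch_zero, Nat.sub_zero]
    field_simp
  beta_reduce
  rw [factor, unit, sum_div]
  refine sum_congr rfl fun ⟨r, j⟩ hrj => ?_
  obtain rfl := HasAntidiagonal.mem_antidiagonal.mp hrj
  have h := hb (r + j)
  have h' := hb' (r + j)
  rw [poch_add, mul_ne_zero_iff] at h h'
  obtain ⟨hr, hj⟩ := h
  obtain ⟨hr', hj'⟩ := h'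
  rw [poch_add (1 + a - b), poch_add (1 + a - b')]
  field_simp

lemma cast_descFactorial_succ (m k : ℕ) :
    (m.descFactorial (k + 1) : ℂ) = (m - k) * m.descFactorial k := by
  rcases le_or_gt k m with h | h
  · rw [Nat.descFactorial_succ, Nat.cast_mul, Nat.cast_sub h]
  · simp [Nat.descFactorial_of_lt h]

/-- The summand `m! α₂ₖ / ((m - 2k)! Γ(1 + 2x + m + 2k))` of the Bailey pair supported on the even
integers. -/
def evenPairTerm (x : ℂ) (m k : ℕ) : ℂ :=
  (x + 2 * k) * poch x k / (k.factorial : ℂ) * m.descFactorial (2 * k) *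
    (Gamma (1 + 2 * x + m + 2 * k))⁻¹

/-- The certificate by which the recurrence in `m` of the sum of `evenPairTerm x m` telescopes. -/
def evenPairCert (x : ℂ) (m k : ℕ) : ℂ :=
  -2 * (x + 2 * k - 1) * (k / (m + 1)) * (poch x k / (k.factorial : ℂ)) *
    (m + 1).descFactorial (2 * k) * (Gamma (2 * x + m + 2 * k))⁻¹

lemma evenPairTerm_recurrence (x : ℂ) (m k : ℕ) :
    (2 * x + 2 * m) * (2 * x + 2 * m + 1) * evenPairTerm x (m + 1) k -
        (2 * x + 4 * m) * evenPairTerm x m k =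
      evenPairCert x m (k + 1) - evenPairCert x m k := by
  set g := (Gamma (2 * x + m + 2 * k + 1 + 1))⁻¹ with hg
  have desc : (m.descFactorial (2 * k) : ℂ) =
      (m + 1 - 2 * k) * (m + 1).descFactorial (2 * k) / (m + 1) := by
    have h := cast_descFactorial_succ (m + 1) (2 * k)
    rw [Nat.succ_descFactorial_succ] at h
    rw [eq_div_iff (Nat.cast_add_one_ne_zero m)]
    push_cast at h
    linear_combination h
  simp only [evenPairTerm, evenPairCert]
  rw [inv_Gamma_eq_mul (2 * x + m + 2 * k), inv_Gamma_eq_mul (2 * x + m + 2 * k + 1), ← hg,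
    show 1 + 2 * x + m + 2 * k = 2 * x + m + 2 * k + 1 by ring,
    inv_Gamma_eq_mul (2 * x + m + 2 * k + 1), ← hg,
    show 1 + 2 * x + (m + 1 : ℕ) + 2 * k = 2 * x + m + 2 * k + 1 + 1 by push_cast; ring,
    show 2 * x + m + 2 * (k + 1 : ℕ) = 2 * x + m + 2 * k + 1 + 1 by push_cast; ring, ← hg,
    mul_add_one 2 k, cast_descFactorial_succ, cast_descFactorial_succ, desc, poch_succ,
    Nat.factorial_succ]
  have hm := Nat.cast_add_one_ne_zero (R := ℂ) m
  have hk := Nat.cast_add_one_ne_zero (R := ℂ) k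
  push_cast
  field_simp
  ring

lemma sum_evenPairTerm (x : ℂ) (hx : ∀ k : ℕ, 2 * x + k ≠ 0) {m K : ℕ} (hK : m < K) :
    ∑ k ∈ range K, evenPairTerm x m k =
      x * (Gamma (1 + 2 * x))⁻¹ * (poch (x / 2) m / (poch x m * poch (x + 1 / 2) m)) := by
  induction m with
  | zero =>
    rw [sum_eq_single_of_mem 0 (mem_range.mpr hK) fun k _ hk => ?_]
    · simp [evenPairTerm]
    · simp [evenPairTerm, Nat.descFactorial_of_lt (show 0 < 2 * k by omega)]
  | succ m ih =>
    have recurrence : (2 * x + 2 * m) * (2 * x + 2 * m + 1) *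
        ∑ k ∈ range K, evenPairTerm x (m + 1) k = (2 * x + 4 * m) *
        ∑ k ∈ range K, evenPairTerm x m k := by
      rw [← sub_eq_zero, mul_sum, mul_sum, ← sum_sub_distrib,
        sum_congr rfl fun k _ => evenPairTerm_recurrence x m k, sum_range_sub]
      simp [evenPairCert, Nat.descFactorial_of_lt (show m + 1 < 2 * K by omega)]
    have h₀ : 2 * x + 2 * m ≠ 0 := by simpa using hx (2 * m)
    have h₁ : 2 * x + 2 * m + 1 ≠ 0 := by simpa [add_assoc] using hx (2 * m + 1)
    have ratio : (2 * x + 2 * m) * (2 * x + 2 * m + 1) *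
        ((x / 2 + m) / ((x + m) * (x + 1 / 2 + m))) = 2 * x + 4 * m := by
      rw [← mul_div_assoc, div_eq_iff (mul_ne_zero (fun h => h₀ (by linear_combination 2 * h))
        fun h => h₁ (by linear_combination 2 * h))]
      ring
    rw [← mul_right_inj' (mul_ne_zero h₀ h₁), recurrence, ih (by omega), ← ratio, poch_succ,
      poch_succ, poch_succ, mul_mul_mul_comm (poch x m), mul_div_mul_comm]
    ring

lemma sum_range_ite_even {M : Type*} [AddCommMonoid M] (f : ℕ → M) (K : ℕ) :
    ∑ r ∈ range (2 * K), (if Even r then f r else 0) = ∑ k ∈ range K, f (2 * k) := by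
  induction K with
  | zero => simp
  | succ K ih => simp [mul_add_one, sum_range_succ, ih]

theorem isBaileyPair_even (x : ℂ) (hx : ∀ k : ℕ, 2 * x + k ≠ 0) :
    IsBaileyPair (2 * x)
      (fun r => if Even r then (x + r) * (poch x (r / 2) / ((r / 2).factorial : ℂ)) else 0)
      (fun m => x * (Gamma (1 + 2 * x))⁻¹ *
        (poch (x / 2) m / (poch x m * poch (x + 1 / 2) m * (m.factorial : ℂ)))) := by
  intro m
  beta_reduce
  rw [← div_div, mul_div_assoc', ← sum_evenPairTerm x hx m.lt_succ_self]
  have even_terms (k : ℕ) : evenPairTerm x m k = (x + (2 * k : ℕ)) * (poch x (2 * k / 2) /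
      ((2 * k / 2).factorial : ℂ)) * m.descFactorial (2 * k) *
        (Gamma (1 + 2 * x + m + (2 * k : ℕ)))⁻¹ := by
    rw [evenPairTerm, Nat.mul_div_cancel_left k two_pos]; push_cast; ring
  rw [sum_congr rfl fun k _ => even_terms k, ← sum_range_ite_even (fun r => (x + r) *
      (poch x (r / 2) / ((r / 2).factorial : ℂ)) * m.descFactorial r *
        (Gamma (1 + 2 * x + m + r))⁻¹),
    ← sum_subset (range_subset_range.mpr (by omega : m + 1 ≤ 2 * (m + 1))) fun r _ hr => ?_,
    ← Nat.sum_antidiagonal_eq_sum_range_succ_mk (fun p : ℕ × ℕ => if Even p.1 then (x + p.1) *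
      (poch x (p.1 / 2) / ((p.1 / 2).factorial : ℂ)) * m.descFactorial p.1 *
        (Gamma (1 + 2 * x + m + p.1))⁻¹ else 0), sum_div]
  · refine sum_congr rfl fun ⟨r, j⟩ hrj => ?_
    obtain rfl := HasAntidiagonal.mem_antidiagonal.mp hrj
    have factorials := Nat.factorial_mul_descFactorial (Nat.le_add_right r j)
    rw [Nat.add_sub_cancel_left] at factorials
    rw [← factorials, show 1 + 2 * x + (r + j : ℕ) + r = 1 + 2 * x + 2 * r + j by push_cast; ring]
    have : ((r + j).descFactorial r : ℂ) ≠ 0 :=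
      Nat.cast_ne_zero.mpr (Nat.descFactorial_eq_zero_iff_lt.not.mpr (by omega))
    split_ifs
    · push_cast
      field_simp
    · simp
  · have : m < r := by simpa using hr
    simp [Nat.descFactorial_of_lt this]

end BaileyPair

section GammaQuotient

lemma Gamma_add_natCast_ne_zero {z : ℂ} {k : ℕ} (h : -z.re < k) : Gamma (z + k) ≠ 0 :=
  Gamma_ne_zero_of_re_pos (by rw [add_re, natCast_re]; linarith)

lemma eventually_Gamma_add_natCast_ne_zero (z : ℂ) : ∀ᶠ N : ℕ in atTop, Gamma (z + N) ≠ 0 := by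
  obtain ⟨k, hk⟩ := exists_nat_gt (-z.re)
  filter_upwards [eventually_ge_atTop k] with N hN
  exact Gamma_add_natCast_ne_zero (hk.trans_le (Nat.cast_le.mpr hN))

lemma poch_ne_zero_of_Gamma_ne_zero {z : ℂ} (hz : Gamma z ≠ 0) (k : ℕ) : poch z k ≠ 0 :=
  left_ne_zero_of_mul (inv_Gamma_eq_poch_mul z k ▸ inv_ne_zero hz)

lemma tendsto_factorial_mul_cpow_mul_inv_Gamma {z : ℂ} (hz : Gamma z ≠ 0) :
    Tendsto (fun N : ℕ => (N.factorial : ℂ) * (N : ℂ) ^ z * (Gamma (z + (N + 1 : ℕ)))⁻¹)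
      atTop (𝓝 1) := by
  have euler := (GammaSeq_tendsto_Gamma z).mul_const (Gamma z)⁻¹
  rw [mul_inv_cancel₀ hz] at euler
  refine euler.congr fun N => ?_
  have poch_ne := poch_ne_zero_of_Gamma_ne_zero hz (N + 1)
  rw [GammaSeq, prod_range_add_eq_poch, inv_Gamma_eq_poch_mul z (N + 1)]
  field_simp

theorem tendsto_Gamma_quotient {p q r s : ℂ} (h : p + q = r + s) :
    Tendsto (fun N : ℕ => Gamma (p + N) * Gamma (q + N) * (Gamma (r + N))⁻¹ * (Gamma (s + N))⁻¹)
      atTop (𝓝 1) := by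
  obtain ⟨k, hp, hq, hr, hs⟩ := ((eventually_Gamma_add_natCast_ne_zero p).and
    ((eventually_Gamma_add_natCast_ne_zero q).and ((eventually_Gamma_add_natCast_ne_zero r).and
      (eventually_Gamma_add_natCast_ne_zero s)))).exists
  have lim := ((tendsto_factorial_mul_cpow_mul_inv_Gamma hr).mul
    (tendsto_factorial_mul_cpow_mul_inv_Gamma hs)).div
    ((tendsto_factorial_mul_cpow_mul_inv_Gamma hp).mul
      (tendsto_factorial_mul_cpow_mul_inv_Gamma hq)) (by norm_num)
  simp only [mul_one, div_one] at lim
  rw [← tendsto_add_atTop_iff_nat (k + 1)]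
  refine lim.congr' ?_
  filter_upwards [eventually_ne_atTop 0] with N hN
  have hN' : (N : ℂ) ≠ 0 := Nat.cast_ne_zero.mpr hN
  have shift (z : ℂ) : z + k + (N + 1 : ℕ) = z + (N + (k + 1) : ℕ) := by push_cast; ring
  have powers : (N : ℂ) ^ (r + k) * (N : ℂ) ^ (s + k) = (N : ℂ) ^ (p + k) * (N : ℂ) ^ (q + k) := by
    rw [← cpow_add _ _ hN', ← cpow_add _ _ hN']
    congr 1
    linear_combination -h
  have cpow_ne (z : ℂ) : (N : ℂ) ^ z ≠ 0 := cpow_ne_zero_iff.mpr (.inl hN')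
  have hp' := cpow_ne (p + k)
  have hq' := cpow_ne (q + k)
  have hN! := natCast_factorial_ne_zero N
  simp only [Pi.div_apply, shift]
  calc _ = (N.factorial : ℂ) ^ 2 * ((N : ℂ) ^ (r + k) * (N : ℂ) ^ (s + k)) *
        ((Gamma (r + (N + (k + 1) : ℕ)))⁻¹ * (Gamma (s + (N + (k + 1) : ℕ)))⁻¹) /
        ((N.factorial : ℂ) ^ 2 * ((N : ℂ) ^ (p + k) * (N : ℂ) ^ (q + k)) *
        ((Gamma (p + (N + (k + 1) : ℕ)))⁻¹ * (Gamma (q + (N + (k + 1) : ℕ)))⁻¹)) := by ring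
    _ = _ := by
      rw [powers]
      field_simp

end GammaQuotient

section Weights

lemma prod_range_sub_add_eq_poch {R : Type*} [CommRing R] (x : R) (m l : ℕ) :
    ∏ i ∈ range m, (((m + l : ℕ) : R) - i + x) = poch (l + 1 + x) m := by
  rw [← prod_range_add_eq_poch, ← prod_range_reflect]
  refine prod_congr rfl fun i hi => ?_
  have : m - 1 - i + (i + 1) = m := by have := mem_range.mp hi; omega
  have cast : ((m - 1 - i : ℕ) : R) + (i + 1) = m := by exact_mod_cast congrArg Nat.cast this
  push_cast
  linear_combination -cast

lemma factorial_add_eq_mul_poch {R : Type*} [CommRing R] (m l : ℕ) :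
    ((m + l).factorial : R) = l.factorial * poch (l + 1 : R) m := by
  rw [← poch_one, add_comm m l, poch_add, poch_one, add_comm (1 : R)]

/-- The weight of the `m`-th term on the Pfaff–Saalschütz side of the finite Bailey lemma of
order `N`. -/
def saalWeight (z : ℂ) (N m : ℕ) : ℂ := ∏ i ∈ range m, ((N : ℂ) - i) / (N - i + z)

/-- The weight of the `r`-th term on the well-poised side of the finite Bailey lemma of
order `N`. -/
def poisedWeight (z : ℂ) (N r : ℕ) : ℂ := ∏ i ∈ range r, ((N : ℂ) - i) / (N + z + i)

lemma saalWeight_add_left (z : ℂ) (m l : ℕ) :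
    saalWeight z (m + l) m = poch (l + 1 : ℂ) m / poch (l + 1 + z) m := by
  rw [saalWeight, prod_div_distrib, prod_range_sub_add_eq_poch]
  congr 1
  simpa using prod_range_sub_add_eq_poch (0 : ℂ) m l

lemma poisedWeight_add_left (z : ℂ) (r l : ℕ) :
    poisedWeight z (r + l) r = poch (l + 1 : ℂ) r / poch ((r + l : ℕ) + z) r := by
  rw [poisedWeight, prod_div_distrib, prod_range_add_eq_poch]
  congr 1
  simpa using prod_range_sub_add_eq_poch (0 : ℂ) r l

lemma saalWeight_eq_zero (z : ℂ) {N m : ℕ} (h : N < m) : saalWeight z N m = 0 :=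
  prod_eq_zero (mem_range.mpr h) (by simp)

lemma poisedWeight_eq_zero (z : ℂ) {N r : ℕ} (h : N < r) : poisedWeight z N r = 0 :=
  prod_eq_zero (mem_range.mpr h) (by simp)

lemma tendsto_natCast_add_div_natCast_add (u v : ℂ) :
    Tendsto (fun N : ℕ => ((N : ℂ) + u) / (N + v)) atTop (𝓝 1) := by
  have one_add (w : ℂ) : Tendsto (fun N : ℕ => 1 + w / (N : ℂ)) atTop (𝓝 1) := by
    simpa using (tendsto_const_div_atTop_nhds_zero_nat w).const_add 1
  have lim := (one_add u).div (one_add v) one_ne_zero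
  rw [div_one] at lim
  refine lim.congr' ?_
  filter_upwards [eventually_ne_atTop 0] with N hN
  have hN' : (N : ℂ) ≠ 0 := Nat.cast_ne_zero.mpr hN
  rw [Pi.div_apply, one_add_div hN', one_add_div hN', div_div_div_cancel_right₀ hN']

lemma tendsto_saalWeight (z : ℂ) (m : ℕ) : Tendsto (fun N => saalWeight z N m) atTop (𝓝 1) := by
  rw [← prod_const_one (s := range m)]
  refine tendsto_finsetProd _ fun i _ => ?_
  simpa only [sub_eq_add_neg, add_assoc] using
    tendsto_natCast_add_div_natCast_add (-i) (-i + z)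

lemma tendsto_poisedWeight (z : ℂ) (r : ℕ) :
    Tendsto (fun N => poisedWeight z N r) atTop (𝓝 1) := by
  rw [← prod_const_one (s := range r)]
  refine tendsto_finsetProd _ fun i _ => ?_
  simpa only [sub_eq_add_neg, add_assoc] using
    tendsto_natCast_add_div_natCast_add (-i) (z + i)

lemma norm_saalWeight_le_one {z : ℂ} (hz : 0 ≤ z.re) (N m : ℕ) : ‖saalWeight z N m‖ ≤ 1 := by
  rcases lt_or_ge N m with h | h
  · simp [saalWeight_eq_zero z h]
  rw [saalWeight, norm_prod]
  refine prod_le_one (fun _ _ => norm_nonneg _) fun i hi => ?_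
  have hi' : i ≤ N := (mem_range.mp hi).le.trans h
  rw [norm_div, ← Nat.cast_sub hi', norm_natCast]
  refine div_le_one_of_le₀ (le_trans ?_ (re_le_norm _)) (norm_nonneg _)
  simp [hz]

lemma exists_eventually_norm_poisedWeight_le (z : ℂ) :
    ∃ C, ∀ᶠ N : ℕ in atTop, ∀ r, ‖poisedWeight z N r‖ ≤ C := by
  obtain ⟨K, hK⟩ := exists_nat_ge ‖z‖
  refine ⟨2 ^ K, ?_⟩
  filter_upwards [eventually_ge_atTop (2 * K + 1)] with N hN r
  rcases lt_or_ge N r with h | h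
  · simp [poisedWeight_eq_zero z h]
  have hNK : (2 : ℝ) * K + 1 ≤ N := mod_cast hN
  have factor_le {i : ℕ} (hi : i ∈ range r) :
      ‖((N : ℂ) - i) / (N + z + i)‖ ≤ if i ∈ range K then 2 else 1 := by
    have hi' : i ≤ N := (mem_range.mp hi).le.trans h
    have den : (N : ℝ) + i - K ≤ ‖(N : ℂ) + z + i‖ := by
      have := norm_sub_le_norm_add ((N + i : ℕ) : ℂ) z
      rw [norm_natCast, Nat.cast_add, Nat.cast_add, add_right_comm] at this
      linarith
    have := i.cast_nonneg (α := ℝ)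
    have := K.cast_nonneg (α := ℝ)
    rw [norm_div, ← Nat.cast_sub hi', norm_natCast, Nat.cast_sub hi', div_le_iff₀ (by linarith)]
    split_ifs with hiK
    · linarith
    · have : (K : ℝ) ≤ i := mod_cast not_lt.mp (mt mem_range.mpr hiK)
      linarith
  rw [poisedWeight, norm_prod]
  refine (prod_le_prod (fun _ _ => norm_nonneg _) fun i hi => factor_le hi).trans ?_
  rw [prod_ite_mem, prod_const]
  exact pow_le_pow_right₀ one_le_two ((card_le_card inter_subset_right).trans_eq (card_range K))

lemma tendsto_sum_antidiagonal_mul {𝕜 : Type*} [NormedRing 𝕜] [CompleteSpace 𝕜] {u : ℕ → 𝕜}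
    {w : ℕ → ℕ → 𝕜} {C : ℝ} (hu : Summable fun m => ‖u m‖)
    (hw : ∀ m, Tendsto (fun N => w N m) atTop (𝓝 1)) (hw_zero : ∀ {N m}, N < m → w N m = 0)
    (hw_le : ∀ᶠ N in atTop, ∀ m, ‖w N m‖ ≤ C) :
    Tendsto (fun N => ∑ p ∈ antidiagonal N, u p.1 * w N p.1) atTop (𝓝 (∑' m, u m)) := by
  have sum_eq (N : ℕ) : ∑' m, u m * w N m = ∑ p ∈ antidiagonal N, u p.1 * w N p.1 := by
    rw [Nat.sum_antidiagonal_eq_sum_range_succ_mk]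
    refine tsum_eq_sum fun m hm => ?_
    rw [hw_zero (by simpa [Nat.lt_succ_iff] using hm), mul_zero]
  simp only [← sum_eq]
  refine tendsto_tsum_of_dominated_convergence (bound := fun m => ‖u m‖ * C) (hu.mul_right C)
    (fun m => by simpa using (hw m).const_mul (u m)) ?_
  filter_upwards [hw_le] with N hN m
  exact (norm_mul_le _ _).trans (mul_le_mul_of_nonneg_left (hN m) (norm_nonneg _))

end Weights

section BaileyLemma

/-- The quotient `(c)ₖ / Γ(b + k)`, which is entire in both parameters. -/
def pochDivGamma (c b : ℂ) (k : ℕ) : ℂ := poch c k * (Gamma (b + k))⁻¹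

/-- The terms of the well-poised series which Bailey's lemma attaches to the first member `α` of
a Bailey pair relative to `a`. -/
def baileyTerm (a c d : ℂ) (α : ℕ → ℂ) (r : ℕ) : ℂ :=
  α r * (pochDivGamma c (1 + a - c) r * pochDivGamma d (1 + a - d) r)

lemma inv_Gamma_mul_saalWeight {z : ℂ} (hz : 0 ≤ z.re) (m l : ℕ) :
    (Gamma (1 + z))⁻¹ * saalWeight z (m + l) m =
      poch (1 + z) l / (l.factorial : ℂ) * (m + l).factorial *
        (Gamma (1 + z + (m + l : ℕ)))⁻¹ := by
  have poch_ne : poch (l + 1 + z) m ≠ 0 := by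
    refine poch_ne_zero_of_Gamma_ne_zero (Gamma_ne_zero_of_re_pos ?_) m
    simp only [add_re, natCast_re, one_re]
    positivity
  have hl := natCast_factorial_ne_zero l
  rw [saalWeight_add_left, factorial_add_eq_mul_poch, inv_Gamma_eq_poch_mul _ (m + l),
    add_comm m l, poch_add, show 1 + z + l = l + 1 + z by ring]
  field_simp

lemma baileyTerm_mul_poisedWeight {a c d : ℂ} {r l : ℕ} (α : ℕ → ℂ)
    (hc : Gamma (1 + a - c + (r + l : ℕ)) ≠ 0) (hd : Gamma (1 + a - d + (r + l : ℕ)) ≠ 0)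
    (ha : Gamma (1 + a + (r + l : ℕ)) ≠ 0) :
    Gamma (1 + a - c + (r + l : ℕ)) * Gamma (1 + a - d + (r + l : ℕ)) *
      (Gamma (1 + a + (r + l : ℕ)))⁻¹ *
        (baileyTerm a c d α r * poisedWeight (1 + a) (r + l) r) =
      (r + l).factorial * (α r * poch c r * poch d r * poch (1 + a - c + r) l *
        poch (1 + a - d + r) l / (l.factorial : ℂ) * (Gamma (1 + a + 2 * r + l))⁻¹) := by
  have split (z : ℂ) : (Gamma (z + r))⁻¹ = poch (z + r) l * (Gamma (z + (r + l : ℕ)))⁻¹ := by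
    rw [inv_Gamma_eq_poch_mul (z + r) l, add_assoc z, ← Nat.cast_add]
  have poch_ne := poch_ne_zero_of_Gamma_ne_zero ha r
  have hl := natCast_factorial_ne_zero l
  rw [poisedWeight_add_left, factorial_add_eq_mul_poch, baileyTerm, pochDivGamma, pochDivGamma,
    split, split, inv_Gamma_eq_poch_mul (1 + a + (r + l : ℕ)) r, add_comm ((r + l : ℕ) : ℂ),
    show 1 + a + ((r + l : ℕ) : ℂ) + r = 1 + a + 2 * r + l by push_cast; ring]
  generalize (Gamma (1 + a + 2 * r + l))⁻¹ = g
  field_simp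

namespace IsBaileyPair

variable {a c d : ℂ} {α β : ℕ → ℂ}

theorem sum_mul_weight_eq (h : IsBaileyPair a α β) (hre : 0 ≤ (a - c - d).re) {N : ℕ}
    (hc : Gamma (1 + a - c + N) ≠ 0) (hd : Gamma (1 + a - d + N) ≠ 0)
    (ha : Gamma (1 + a + N) ≠ 0) :
    Gamma (1 + a - c + N) * Gamma (1 + a - d + N) * (Gamma (1 + a - c - d + N))⁻¹ *
        (Gamma (1 + a + N))⁻¹ *
        ∑ p ∈ antidiagonal N, baileyTerm a c d α p.1 * poisedWeight (1 + a) N p.1 =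
      (Gamma (1 + a - c - d))⁻¹ *
        ∑ p ∈ antidiagonal N, poch c p.1 * poch d p.1 * β p.1 * saalWeight (a - c - d) N p.1 := by
  have finite := congrArg (fun t => (N.factorial : ℂ) * (Gamma (1 + a - c - d + N))⁻¹ * t)
    (h.sum_eq c d N)
  simp only [mul_sum] at finite ⊢
  refine Eq.trans (sum_congr rfl fun p hp => ?_)
    (finite.symm.trans (sum_congr rfl fun p hp => ?_))
  · obtain ⟨r, l⟩ := p
    obtain rfl := HasAntidiagonal.mem_antidiagonal.mp hp
    linear_combination (Gamma (1 + a - c - d + (r + l : ℕ)))⁻¹ *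
      baileyTerm_mul_poisedWeight α hc hd ha
  · obtain ⟨m, l⟩ := p
    obtain rfl := HasAntidiagonal.mem_antidiagonal.mp hp
    have weight := inv_Gamma_mul_saalWeight hre m l
    rw [show 1 + (a - c - d) = 1 + a - c - d by ring] at weight
    linear_combination -(poch c m * poch d m * β m) * weight

theorem tsum_eq_of_re_nonneg (h : IsBaileyPair a α β) (hre : 0 ≤ (a - c - d).re)
    (hα : Summable (baileyTerm a c d α)) (hβ : Summable fun m => poch c m * poch d m * β m) :
    ∑' r, baileyTerm a c d α r =
      (Gamma (1 + a - c - d))⁻¹ * ∑' m, poch c m * poch d m * β m := by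
  obtain ⟨C, hC⟩ := exists_eventually_norm_poisedWeight_le (1 + a)
  have lim_poised := (tendsto_Gamma_quotient
    (show 1 + a - c + (1 + a - d) = 1 + a - c - d + (1 + a) by ring)).mul
    (tendsto_sum_antidiagonal_mul hα.norm (tendsto_poisedWeight (1 + a))
      (poisedWeight_eq_zero _) hC)
  have lim_saal := (tendsto_sum_antidiagonal_mul hβ.norm (tendsto_saalWeight (a - c - d))
    (saalWeight_eq_zero _) (.of_forall (norm_saalWeight_le_one hre))).const_mul
    (Gamma (1 + a - c - d))⁻¹
  rw [one_mul] at lim_poised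
  refine tendsto_nhds_unique lim_poised (lim_saal.congr' ?_)
  filter_upwards [eventually_Gamma_add_natCast_ne_zero (1 + a - c),
    eventually_Gamma_add_natCast_ne_zero (1 + a - d),
    eventually_Gamma_add_natCast_ne_zero (1 + a)] with N hc hd ha
  exact (h.sum_mul_weight_eq hre hc hd ha).symm

end IsBaileyPair

end BaileyLemma

section Growth

lemma exists_le_mul_rpow_of_succ_le_mul_exp (τ : ℝ) (k₀ : ℕ) :
    ∃ C, ∀ u : ℕ → ℝ, 0 ≤ u k₀ → (∀ k ≥ k₀, u (k + 1) ≤ u k * Real.exp (τ / (k + 1))) →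
      ∀ k ≥ k₀, k ≠ 0 → u k ≤ C * u k₀ * (k : ℝ) ^ τ := by
  refine ⟨Real.exp (|τ| - τ * harmonic k₀), fun u hu₀ hu k hk hk0 => ?_⟩
  have le_harmonic : u k ≤ u k₀ * Real.exp (τ * harmonic k - τ * harmonic k₀) := by
    clear hk0
    induction k, hk using Nat.le_induction with
    | base => rw [sub_self, Real.exp_zero, mul_one]
    | succ k hk ih =>
      calc u (k + 1) ≤ u k * Real.exp (τ / (k + 1)) := hu k hk
        _ ≤ u k₀ * Real.exp (τ * harmonic k - τ * harmonic k₀) * Real.exp (τ / (k + 1)) := by gcongr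
        _ = _ := by
          rw [mul_assoc, ← Real.exp_add, harmonic_succ]
          push_cast
          ring_nf
  have hk1 : (0 : ℝ) < k := Nat.cast_pos.mpr (Nat.pos_of_ne_zero hk0)
  have log_le : Real.log k ≤ harmonic k :=
    (Real.log_le_log hk1 (by simp)).trans (log_add_one_le_harmonic k)
  have harmonic_sub_log : |(harmonic k : ℝ) - Real.log k| ≤ 1 :=
    abs_le.mpr ⟨by linarith, by linarith [harmonic_le_one_add_log k]⟩
  have mul_harmonic_le : τ * harmonic k ≤ τ * Real.log k + |τ| := by
    have := (le_abs_self _).trans ((abs_mul τ _).trans_le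
      (mul_le_of_le_one_right (abs_nonneg τ) harmonic_sub_log))
    linarith
  calc u k ≤ u k₀ * Real.exp (τ * harmonic k - τ * harmonic k₀) := le_harmonic
    _ ≤ u k₀ * Real.exp (|τ| - τ * harmonic k₀ + Real.log k * τ) := by
      gcongr
      linarith
    _ = _ := by
      rw [Real.exp_add, ← Real.rpow_def_of_pos hk1]
      ring

/-- The family `u i` of sequences is `O(k ^ τ')` for every `τ' > τ`, uniformly along the filter
`l`. With `l = 𝓝 c` this is locally uniform growth of order `τ` at the parameter `c`; a single
sequence is treated as a family over `Unit`, with `l = pure ()`. -/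
def GrowthLE {ι : Type*} (l : Filter ι) (τ : ℝ) (u : ι → ℕ → ℂ) : Prop :=
  ∀ τ' > τ, (fun p : ι × ℕ => u p.1 p.2) =O[l ×ˢ atTop] fun p => (p.2 : ℝ) ^ τ'

/-- Growth of order `τ` whose differences have growth of order `τ - 1`, as needed to sum
alternating series. -/
def RegularGrowth {ι : Type*} (l : Filter ι) (τ : ℝ) (u : ι → ℕ → ℂ) : Prop :=
  GrowthLE l τ u ∧ GrowthLE l (τ - 1) fun i k => u i k - u i (k + 1)

variable {ι κ : Type*} {l : Filter ι} {l' : Filter κ} {τ σ : ℝ} {u v : ι → ℕ → ℂ}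

lemma eventually_snd_pos : ∀ᶠ p : ι × ℕ in l ×ˢ atTop, (0 : ℝ) < p.2 :=
  tendsto_snd.eventually (tendsto_natCast_atTop_atTop.eventually_gt_atTop 0)

namespace GrowthLE

lemma comp (h : GrowthLE l τ u) {f : κ → ι} (hf : Tendsto f l' l) :
    GrowthLE l' τ fun i => u (f i) := fun τ' hτ =>
  (h τ' hτ).comp_tendsto (hf.prodMap tendsto_id)

lemma mono (h : GrowthLE l τ u) (hτ : τ ≤ σ) : GrowthLE l σ u := fun τ' h' =>
  h τ' (hτ.trans_lt h')

lemma add (hu : GrowthLE l τ u) (hv : GrowthLE l τ v) : GrowthLE l τ fun i k => u i k + v i k :=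
  fun τ' hτ => (hu τ' hτ).add (hv τ' hτ)

lemma mul (hu : GrowthLE l τ u) (hv : GrowthLE l σ v) :
    GrowthLE l (τ + σ) fun i k => u i k * v i k := by
  intro τ' hτ
  refine ((hu ((τ' + τ - σ) / 2) (by linarith)).mul
    (hv ((τ' - τ + σ) / 2) (by linarith))).congr' .rfl ?_
  filter_upwards [eventually_snd_pos] with p hp
  rw [← Real.rpow_add hp]
  ring_nf

lemma const_mul (h : GrowthLE l τ u) (x : ℂ) : GrowthLE l τ fun i k => x * u i k := fun τ' hτ =>
  (h τ' hτ).const_mul_left x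

lemma neg_one_pow_mul (h : GrowthLE l τ u) : GrowthLE l τ fun i k => (-1) ^ k * u i k :=
  fun τ' hτ => by simpa [← Asymptotics.isBigO_norm_left] using h τ' hτ

lemma of_tendsto {f : ι → ℂ} {x : ℂ} (hf : Tendsto f l (𝓝 x)) : GrowthLE l 0 fun i _ => f i := by
  intro τ' hτ
  refine ((hf.comp tendsto_fst).isBigO_one ℝ).trans ?_
  refine .of_bound 1 ?_
  filter_upwards [tendsto_snd.eventually (eventually_ge_atTop 1)] with p hp
  have : (1 : ℝ) ≤ (p.2 : ℝ) ^ τ' := Real.one_le_rpow (mod_cast hp) hτ.le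
  simpa using this.trans (le_abs_self _)

lemma natCast : GrowthLE l 1 fun _ k => (k : ℂ) := by
  intro τ' hτ
  refine .of_bound 1 ?_
  filter_upwards [tendsto_snd.eventually (eventually_ge_atTop 1)] with p hp
  rw [norm_natCast, one_mul]
  exact (Real.self_le_rpow_of_one_le (mod_cast hp) hτ.le).trans (le_abs_self _)

lemma shift (h : GrowthLE l τ u) : GrowthLE l τ fun i k => u i (k + 1) := by
  intro τ' hτ
  refine ((h τ' hτ).comp_tendsto (tendsto_id.prodMap (tendsto_add_atTop_nat 1))).trans ?_
  refine .of_bound (2 ^ |τ'|) ?_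
  filter_upwards [tendsto_snd.eventually (eventually_ge_atTop 1)] with p hp
  have hp' : (1 : ℝ) ≤ p.2 := mod_cast hp
  have one_le : (1 : ℝ) ≤ 1 + 1 / p.2 := by simp
  have le_two : 1 + 1 / (p.2 : ℝ) ≤ 2 := by
    rw [← one_add_one_eq_two]
    gcongr
    exact (div_le_one (by linarith)).mpr hp'
  have split : ((p.2 + 1 : ℕ) : ℝ) = (1 + 1 / p.2) * p.2 := by
    push_cast
    field_simp
  change ‖((p.2 + 1 : ℕ) : ℝ) ^ τ'‖ ≤ _
  rw [split, Real.mul_rpow (by positivity) (by positivity), norm_mul]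
  gcongr
  rw [Real.norm_of_nonneg (by positivity)]
  exact (Real.rpow_le_rpow_of_exponent_le one_le (le_abs_self τ')).trans
    (Real.rpow_le_rpow (by positivity) le_two (abs_nonneg τ'))

lemma ite_even (h : GrowthLE l τ u) :
    GrowthLE l τ fun i k => if Even k then u i (k / 2) else 0 := by
  intro τ' hτ
  obtain ⟨C, C_pos, hC⟩ := ((h τ' hτ).comp_tendsto
    (tendsto_id.prodMap (Nat.tendsto_div_const_atTop two_ne_zero))).exists_pos
  refine .of_bound (C * 2⁻¹ ^ τ') ?_
  filter_upwards [hC.bound] with p hp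
  split_ifs with even
  · have half : ((p.2 / 2 : ℕ) : ℝ) = 2⁻¹ * p.2 := by
      rw [Nat.cast_div even.two_dvd (by norm_num), Nat.cast_ofNat, div_eq_inv_mul]
    refine hp.trans_eq ?_
    change C * ‖((p.2 / 2 : ℕ) : ℝ) ^ τ'‖ = _
    rw [half, Real.mul_rpow (by norm_num) p.2.cast_nonneg, norm_mul, mul_assoc,
      Real.norm_of_nonneg (Real.rpow_nonneg (by norm_num) τ')]
  · rw [norm_zero]
    positivity

lemma isBigO (h : GrowthLE l τ u) (hτ : τ < σ) {i : ι} (hi : pure i ≤ l) :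
    u i =O[atTop] fun k : ℕ => (k : ℝ) ^ σ :=
  (h σ hτ).comp_tendsto ((tendsto_const_pure.mono_right hi).prodMk tendsto_id)

lemma summable (h : GrowthLE l τ u) (hτ : τ < -1) {i : ι} (hi : pure i ≤ l) :
    Summable (u i) := by
  obtain ⟨σ, hτσ, hσ⟩ := exists_between hτ
  exact summable_of_isBigO_nat (Real.summable_nat_rpow.mpr hσ) (h.isBigO hτσ hi)

lemma tendsto_zero (h : GrowthLE l τ u) (hτ : τ < 0) {i : ι} (hi : pure i ≤ l) :
    Tendsto (u i) atTop (𝓝 0) := by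
  obtain ⟨σ, hτσ, hσ⟩ := exists_between hτ
  refine (h.isBigO hτσ hi).trans_tendsto ?_
  simpa [Function.comp_def] using
    (tendsto_rpow_neg_atTop (neg_pos.mpr hσ)).comp tendsto_natCast_atTop_atTop

lemma analyticAt_tsum {F : ℂ → ℕ → ℂ} {c : ℂ} (h : GrowthLE (𝓝 c) τ F) (hτ : τ < -1)
    (hF : ∀ k, Differentiable ℂ fun z => F z k) :
    AnalyticAt ℂ (fun z => ∑' k, F z k) c := by
  obtain ⟨σ, hτσ, hσ⟩ := exists_between hτ
  obtain ⟨C, hC⟩ := (h σ hτσ).bound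
  obtain ⟨near, hnear, large, hlarge, bound⟩ := eventually_prod_iff.mp hC
  obtain ⟨k₀, hk₀⟩ := eventually_atTop.mp hlarge
  obtain ⟨U, hU, U_open, hcU⟩ := eventually_nhds_iff.mp hnear
  have bound_tail (k : ℕ) (z : ℂ) (hz : z ∈ U) :
      ‖F z (k + k₀)‖ ≤ C * ‖((k + k₀ : ℕ) : ℝ) ^ σ‖ :=
    bound (hU z hz) (hk₀ _ (Nat.le_add_left k₀ k))
  have summable_bound : Summable fun k : ℕ => C * ‖((k + k₀ : ℕ) : ℝ) ^ σ‖ :=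
    ((summable_nat_add_iff k₀).mpr (Real.summable_nat_rpow.mpr hσ).norm).mul_left C
  have tail : DifferentiableOn ℂ (fun z => ∑' k, F z (k + k₀)) U :=
    differentiableOn_tsum_of_summable_norm summable_bound
      (fun k => (hF (k + k₀)).differentiableOn) U_open bound_tail
  have head : Differentiable ℂ fun z => ∑ k ∈ range k₀, F z k :=
    Differentiable.fun_sum fun k _ => hF k
  refine ((head.analyticAt c).add (tail.analyticAt (U_open.mem_nhds hcU))).congr ?_
  filter_upwards [U_open.mem_nhds hcU] with z hz
  have summable_tail := summable_bound.of_norm_bounded fun k => bound_tail k z hz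
  exact ((summable_nat_add_iff k₀).mp summable_tail).sum_add_tsum_nat_add k₀

end GrowthLE

namespace RegularGrowth

lemma comp (h : RegularGrowth l τ u) {f : κ → ι} (hf : Tendsto f l' l) :
    RegularGrowth l' τ fun i => u (f i) :=
  ⟨h.1.comp hf, h.2.comp hf⟩

lemma mul (hu : RegularGrowth l τ u) (hv : RegularGrowth l σ v) :
    RegularGrowth l (τ + σ) fun i k => u i k * v i k := by
  refine ⟨hu.1.mul hv.1, ?_⟩
  have sum := ((hu.1.mul hv.2).mono (by linarith : _ ≤ τ + σ - 1)).add
    ((hu.2.mul hv.1.shift).mono (by linarith : _ ≤ τ + σ - 1))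
  convert sum using 3
  ring

lemma const_mul (h : RegularGrowth l τ u) (x : ℂ) : RegularGrowth l τ fun i k => x * u i k :=
  ⟨h.1.const_mul x, by simpa only [← mul_sub] using h.2.const_mul x⟩

lemma linear (a : ℂ) : RegularGrowth l 1 fun _ k => a + 2 * k := by
  constructor
  · exact ((GrowthLE.of_tendsto tendsto_const_nhds).mono zero_le_one).add
      (GrowthLE.natCast.const_mul 2)
  · simpa [mul_add] using GrowthLE.of_tendsto (l := l) (tendsto_const_nhds (x := (-2 : ℂ)))

end RegularGrowth

end Growth

section GrowthOfPochhammer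

lemma pochDivGamma_succ (c b : ℂ) (k : ℕ) :
    (b + k) * pochDivGamma c b (k + 1) = (c + k) * pochDivGamma c b k := by
  rw [pochDivGamma, pochDivGamma, poch_succ, inv_Gamma_eq_mul (b + k)]
  push_cast
  ring_nf

lemma pochDivGamma_sub_succ (c b : ℂ) (k : ℕ) :
    pochDivGamma c b k - pochDivGamma c b (k + 1) = (b - c) * pochDivGamma c (b + 1) k := by
  simp only [pochDivGamma]
  rw [poch_succ, inv_Gamma_eq_mul (b + k)]
  push_cast
  ring_nf

lemma differentiable_poch (k : ℕ) : Differentiable ℂ fun c : ℂ => poch c k :=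
  (ascPochhammer ℂ k).differentiable

lemma differentiable_pochDivGamma (k : ℕ) {f g : ℂ → ℂ} (hf : Differentiable ℂ f)
    (hg : Differentiable ℂ g) : Differentiable ℂ fun z => pochDivGamma (f z) (g z) k :=
  ((differentiable_poch k).comp hf).mul
    (differentiable_one_div_Gamma.comp (hg.add_const (k : ℂ)))

lemma continuous_pochDivGamma (k : ℕ) : Continuous fun p : ℂ × ℂ => pochDivGamma p.1 p.2 k := by
  simp only [pochDivGamma]
  exact ((differentiable_poch k).continuous.comp continuous_fst).mul
    (differentiable_one_div_Gamma.continuous.comp (continuous_snd.add_const (k : ℂ)))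

lemma norm_one_add_le_exp (z : ℂ) : ‖1 + z‖ ≤ Real.exp (z.re + ‖z‖ ^ 2 / 2) := by
  have sq_eq : ‖1 + z‖ ^ 2 = 2 * z.re + ‖z‖ ^ 2 + 1 := by
    simp only [Complex.sq_norm, normSq_apply, add_re, add_im, one_re, one_im]
    ring
  refine le_of_sq_le_sq ?_ (Real.exp_pos _).le
  rw [sq_eq, ← Real.exp_nat_mul]
  refine (Real.add_one_le_exp _).trans_eq ?_
  push_cast
  ring_nf

lemma tendsto_natCast_succ_mul_div_add (c b : ℂ) :
    Tendsto (fun p : (ℂ × ℂ) × ℕ => ((p.2 : ℂ) + 1) * ((p.1.1 - p.1.2) / (p.1.2 + p.2)))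
      (𝓝 (c, b) ×ˢ atTop) (𝓝 (c - b)) := by
  have hc : Tendsto (fun p : (ℂ × ℂ) × ℕ => p.1.1) (𝓝 (c, b) ×ˢ atTop) (𝓝 c) :=
    (continuous_fst.tendsto (c, b)).comp tendsto_fst
  have hb : Tendsto (fun p : (ℂ × ℂ) × ℕ => p.1.2) (𝓝 (c, b) ×ˢ atTop) (𝓝 b) :=
    (continuous_snd.tendsto (c, b)).comp tendsto_fst
  have inv : Tendsto (fun p : (ℂ × ℂ) × ℕ => ((p.2 : ℂ))⁻¹) (𝓝 (c, b) ×ˢ atTop) (𝓝 0) :=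
    (tendsto_inv_atTop_nhds_zero_nat (𝕜 := ℂ)).comp tendsto_snd
  have lim := ((inv.const_add 1).mul (hc.sub hb)).div ((hb.mul inv).add_const 1) (by simp)
  simp only [add_zero, one_mul, mul_zero, zero_add, div_one] at lim
  refine lim.congr' ?_
  filter_upwards [tendsto_snd.eventually (eventually_ne_atTop 0)] with p hp
  have hp' : (p.2 : ℂ) ≠ 0 := Nat.cast_ne_zero.mpr hp
  simp only [Pi.div_apply]
  rw [← mul_div_mul_left _ _ hp']
  field_simp

lemma eventually_norm_pochDivGamma_succ_le {c b : ℂ} {τ : ℝ} (hτ : (c - b).re < τ) :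
    ∀ᶠ p : (ℂ × ℂ) × ℕ in 𝓝 (c, b) ×ˢ atTop, ‖pochDivGamma p.1.1 p.1.2 (p.2 + 1)‖ ≤
      ‖pochDivGamma p.1.1 p.1.2 p.2‖ * Real.exp (τ / (p.2 + 1)) := by
  have scaled := tendsto_natCast_succ_mul_div_add c b
  have inv : Tendsto (fun p : (ℂ × ℂ) × ℕ => 1 / ((p.2 : ℝ) + 1)) (𝓝 (c, b) ×ˢ atTop) (𝓝 0) :=
    tendsto_one_div_add_atTop_nhds_zero_nat.comp tendsto_snd
  have exponent := ((continuous_re.tendsto _).comp scaled).add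
    ((scaled.norm.pow 2).mul (inv.mul_const (1 / 2)))
  rw [zero_mul, mul_zero, add_zero] at exponent
  have re_atTop : Tendsto (fun p : (ℂ × ℂ) × ℕ => p.1.2.re + p.2) (𝓝 (c, b) ×ˢ atTop) atTop :=
    (((continuous_re.comp continuous_snd).tendsto (c, b)).comp tendsto_fst).add_atTop
      (tendsto_natCast_atTop_atTop.comp tendsto_snd)
  filter_upwards [exponent.eventually_lt_const hτ, re_atTop.eventually_gt_atTop 0]
    with ⟨⟨c', b'⟩, k⟩ hlt hpos
  have ne_zero : b' + k ≠ 0 := fun h => by simpa [hpos.ne'] using congrArg re h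
  have ratio : pochDivGamma c' b' (k + 1) =
      pochDivGamma c' b' k * (1 + (c' - b') / (b' + k)) := by
    have := pochDivGamma_succ c' b' k
    field_simp
    linear_combination this
  rw [ratio, norm_mul]
  gcongr
  refine (norm_one_add_le_exp _).trans (Real.exp_le_exp.mpr ?_)
  have hk : (0 : ℝ) < k + 1 := by positivity
  rw [le_div_iff₀ hk]
  refine le_trans (le_of_eq ?_) hlt.le
  simp only [Function.comp_apply, ← ofReal_natCast, ← ofReal_one, ← ofReal_add, re_ofReal_mul,
    norm_mul, norm_real, Real.norm_of_nonneg hk.le]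
  field_simp

theorem growthLE_pochDivGamma (c b : ℂ) :
    GrowthLE (𝓝 (c, b)) (c - b).re fun p => pochDivGamma p.1 p.2 := by
  intro τ hτ
  obtain ⟨k₀, ratio_le⟩ : ∃ k₀ : ℕ, ∀ᶠ q : ℂ × ℂ in 𝓝 (c, b), ∀ k ≥ k₀,
      ‖pochDivGamma q.1 q.2 (k + 1)‖ ≤ ‖pochDivGamma q.1 q.2 k‖ * Real.exp (τ / (k + 1)) := by
    obtain ⟨near, hnear, large, hlarge, h⟩ :=
      eventually_prod_iff.mp (eventually_norm_pochDivGamma_succ_le hτ)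
    obtain ⟨k₀, hk₀⟩ := eventually_atTop.mp hlarge
    exact ⟨k₀, hnear.mono fun q hq k hk => h hq (hk₀ k hk)⟩
  obtain ⟨C, hC⟩ := exists_le_mul_rpow_of_succ_le_mul_exp τ k₀
  have start_le : ∀ᶠ q : ℂ × ℂ in 𝓝 (c, b),
      ‖pochDivGamma q.1 q.2 k₀‖ ≤ ‖pochDivGamma c b k₀‖ + 1 :=
    ((continuous_pochDivGamma k₀).norm.tendsto (c, b)).eventually_le_const (lt_add_one _)
  refine .of_bound (|C| * (‖pochDivGamma c b k₀‖ + 1)) ?_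
  filter_upwards [(ratio_le.and start_le).prod_mk
    ((eventually_ge_atTop k₀).and (eventually_ne_atTop 0))]
  rintro ⟨q, k⟩ ⟨⟨q_ratio, q_start⟩, hk, hk0⟩
  refine (hC (fun k => ‖pochDivGamma q.1 q.2 k‖) (norm_nonneg _) q_ratio k hk hk0).trans ?_
  rw [Real.norm_of_nonneg (Real.rpow_nonneg k.cast_nonneg τ)]
  gcongr
  exact le_abs_self C

lemma regularGrowth_pochDivGamma (c b : ℂ) :
    RegularGrowth (𝓝 (c, b)) (c - b).re fun p => pochDivGamma p.1 p.2 := by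
  refine ⟨growthLE_pochDivGamma c b, ?_⟩
  have factor : GrowthLE (𝓝 (c, b)) 0 fun p _ => p.2 - p.1 :=
    .of_tendsto (Continuous.tendsto (by fun_prop) (c, b))
  have shifted := (growthLE_pochDivGamma c (b + 1)).comp (l' := 𝓝 (c, b))
    (f := fun p => (p.1, p.2 + 1)) (Continuous.tendsto (by fun_prop) (c, b))
  simp only [pochDivGamma_sub_succ]
  exact (factor.mul shifted).mono (by simp)

end GrowthOfPochhammer

section NonposInt

lemma Gamma_ne_zero_of_not_isNonposInt {z : ℂ} (hz : ¬ IsNonposInt z) : Gamma z ≠ 0 :=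
  Gamma_ne_zero fun m h => hz ⟨m, h⟩

lemma poch_ne_zero {z : ℂ} (hz : ¬ IsNonposInt z) (k : ℕ) : poch z k ≠ 0 :=
  poch_ne_zero_of_Gamma_ne_zero (Gamma_ne_zero_of_not_isNonposInt hz) k

lemma poch_neg_natCast_eq_zero {p k : ℕ} (h : p < k) : poch (-(p : ℂ)) k = 0 := by
  obtain ⟨i, rfl⟩ := Nat.exists_eq_add_of_le (Nat.succ_le_of_lt h)
  rw [poch_add, poch_succ, neg_add_cancel, mul_zero, zero_mul]

lemma exists_poch_mul_poch_eq_zero {c d : ℂ} (h : IsNonposInt c ∨ IsNonposInt d) :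
    ∃ p : ℕ, ∀ k > p, poch c k * poch d k = 0 := by
  rcases h with ⟨p, rfl⟩ | ⟨p, rfl⟩
  · exact ⟨p, fun k hk => by rw [poch_neg_natCast_eq_zero hk, zero_mul]⟩
  · exact ⟨p, fun k hk => by rw [poch_neg_natCast_eq_zero hk, mul_zero]⟩

lemma poch_div_poch_eq (c : ℂ) {b : ℂ} (hb : ¬ IsNonposInt b) (k : ℕ) :
    poch c k / poch b k = Gamma b * pochDivGamma c b k := by
  have hGamma := Gamma_ne_zero_of_not_isNonposInt hb
  have hpoch := poch_ne_zero hb k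
  have h := inv_Gamma_eq_poch_mul b k
  rw [pochDivGamma, div_eq_iff hpoch]
  linear_combination (Gamma b * poch c k) * h - poch c k * mul_inv_cancel₀ hGamma

lemma regularGrowth_poch_div_poch {ι : Type*} (l : Filter ι) (c : ℂ) {b : ℂ}
    (hb : ¬ IsNonposInt b) :
    RegularGrowth l (c - b).re fun _ k => poch c k / poch b k := by
  simp only [poch_div_poch_eq c hb]
  exact ((regularGrowth_pochDivGamma c b).comp tendsto_const_nhds).const_mul _

lemma not_isNonposInt_one : ¬ IsNonposInt 1 := by
  rintro ⟨m, hm⟩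
  have : (m : ℂ) + 1 = 0 := by rw [hm]; ring
  exact Nat.cast_add_one_ne_zero m this

lemma regularGrowth_poch_div_factorial {ι : Type*} (l : Filter ι) (c : ℂ) :
    RegularGrowth l (c.re - 1) fun _ k => poch c k / (k.factorial : ℂ) := by
  simpa only [poch_one, sub_re, one_re] using regularGrowth_poch_div_poch l c not_isNonposInt_one

end NonposInt

section BaileyLemmaContinuation

lemma eq_of_eq_of_re_le {F G : ℂ → ℂ} {c : ℂ} {h : ℝ} (hF : ∀ z : ℂ, z.re ≤ c.re → AnalyticAt ℂ F z)
    (hG : ∀ z : ℂ, z.re ≤ c.re → AnalyticAt ℂ G z)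
    (hFG : ∀ z : ℂ, z.re ≤ c.re → z.re < h → F z = G z) : F c = G c := by
  have hz₀ : ((min c.re h - 1 : ℝ) : ℂ).re < min c.re h := by
    rw [ofReal_re]
    exact sub_one_lt _
  refine AnalyticOnNhd.eqOn_of_preconnected_of_eventuallyEq (U := {z : ℂ | z.re ≤ c.re}) hF hG
    (convex_halfSpace_re_le c.re).isPreconnected (hz₀.le.trans (min_le_left _ _)) ?_ (le_refl c.re)
  filter_upwards [(isOpen_lt continuous_re continuous_const).mem_nhds hz₀] with z hz
  exact hFG z (hz.le.trans (min_le_left _ _)) (hz.trans_le (min_le_right _ _))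

/-- The sum `∑ (-1) ^ k * F k` after one step of Euler's transformation, which gains one order of
decay when `F` varies slowly. -/
def alternatingSum (F : ℕ → ℂ) : ℂ := F 0 / 2 + 1 / 2 * ∑' k, (-1) ^ k * (F k - F (k + 1))

lemma sum_range_neg_one_pow_mul (F : ℕ → ℂ) (N : ℕ) :
    ∑ k ∈ range N, (-1) ^ k * F k = F 0 / 2 - (-1) ^ N * F N / 2 +
      1 / 2 * ∑ k ∈ range N, (-1) ^ k * (F k - F (k + 1)) := by
  induction N with
  | zero => simp
  | succ N ih =>
    rw [sum_range_succ, ih, sum_range_succ]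
    ring

lemma RegularGrowth.tendsto_sum_neg_one_pow_mul {ι : Type*} {l : Filter ι} {τ : ℝ}
    {u : ι → ℕ → ℂ} (h : RegularGrowth l τ u) (hτ : τ < 0) {i : ι} (hi : pure i ≤ l) :
    Tendsto (fun N => ∑ k ∈ range N, (-1) ^ k * u i k) atTop (𝓝 (alternatingSum (u i))) := by
  have boundary := (h.1.neg_one_pow_mul.tendsto_zero hτ hi).div_const 2
  have sum := (h.2.neg_one_pow_mul.summable (by linarith) hi).hasSum.tendsto_sum_nat
  simp only [sum_range_neg_one_pow_mul (u i)]
  have lim := (boundary.const_sub (u i 0 / 2)).add (sum.const_mul (1 / 2))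
  rwa [zero_div, sub_zero] at lim

lemma RegularGrowth.analyticAt_alternatingSum {F : ℂ → ℕ → ℂ} {c : ℂ} {τ : ℝ}
    (h : RegularGrowth (𝓝 c) τ F) (hτ : τ < 0) (hF : ∀ k, Differentiable ℂ fun z => F z k) :
    AnalyticAt ℂ (fun z => alternatingSum (F z)) c :=
  ((hF 0).analyticAt c |>.div_const).add <| analyticAt_const.mul <|
    h.2.neg_one_pow_mul.analyticAt_tsum (by linarith) fun k =>
      ((hF k).sub (hF (k + 1))).const_mul _

variable {a c d : ℂ} {α β : ℕ → ℂ} {κ ν : ℝ}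

lemma differentiable_baileyTerm (a d : ℂ) (α : ℕ → ℂ) (k : ℕ) :
    Differentiable ℂ fun c => baileyTerm a c d α k :=
  ((differentiable_pochDivGamma k differentiable_id (differentiable_id.const_sub _)).mul_const
    _).const_mul _

lemma regularGrowth_pochDivGamma_mul (a c d : ℂ) :
    RegularGrowth (𝓝 c) (2 * c.re + 2 * d.re - 2 * (1 + a).re)
      fun z k => pochDivGamma z (1 + a - z) k * pochDivGamma d (1 + a - d) k := by
  have h := ((regularGrowth_pochDivGamma c (1 + a - c)).comp (l' := 𝓝 c)
    (f := fun z => (z, 1 + a - z)) (Continuous.tendsto (by fun_prop) c)).mul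
      ((regularGrowth_pochDivGamma d (1 + a - d)).comp tendsto_const_nhds)
  have order : (c - (1 + a - c)).re + (d - (1 + a - d)).re =
      2 * c.re + 2 * d.re - 2 * (1 + a).re := by
    simp only [sub_re]
    ring
  rwa [order] at h

lemma growthLE_baileyTerm (hα : GrowthLE (pure ()) κ fun _ => α) (a c d : ℂ) :
    GrowthLE (𝓝 c) (κ + (2 * c.re + 2 * d.re - 2 * (1 + a).re)) fun z => baileyTerm a z d α :=
  (hα.comp tendsto_const_pure).mul (regularGrowth_pochDivGamma_mul a c d).1

lemma regularGrowth_baileyTerm (hα : RegularGrowth (pure ()) κ fun _ => α) (a c d : ℂ) :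
    RegularGrowth (𝓝 c) (κ + (2 * c.re + 2 * d.re - 2 * (1 + a).re)) fun z => baileyTerm a z d α :=
  (hα.comp tendsto_const_pure).mul (regularGrowth_pochDivGamma_mul a c d)

lemma growthLE_poch_mul_poch_mul
    (hβ : GrowthLE (pure ()) ν fun _ m => β m * (m.factorial : ℂ) ^ 2) (c d : ℂ) :
    GrowthLE (𝓝 c) (c.re + d.re - 2 + ν) fun z m => poch z m * poch d m * β m := by
  have hc := (growthLE_pochDivGamma c 1).comp (l' := 𝓝 c) (f := fun z => (z, 1))
    (Continuous.tendsto (by fun_prop) c)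
  have h := (hc.mul (regularGrowth_poch_div_factorial (𝓝 c) d).1).mul (hβ.comp tendsto_const_pure)
  convert h using 3 with z m
  · simp only [sub_re, one_re]
    ring
  · have hm := natCast_factorial_ne_zero m
    rw [pochDivGamma, add_comm 1 (m : ℂ), Gamma_nat_eq_factorial]
    field_simp

lemma differentiable_inv_Gamma_sub_sub (a d : ℂ) :
    Differentiable ℂ fun z => (Gamma (1 + a - z - d))⁻¹ :=
  differentiable_one_div_Gamma.comp ((differentiable_id.const_sub _).sub_const _)

lemma analyticAt_inv_Gamma_mul_tsum
    (hβ : GrowthLE (pure ()) ν fun _ m => β m * (m.factorial : ℂ) ^ 2) (a : ℂ)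
    (h : c.re + d.re + ν < 1) :
    AnalyticAt ℂ (fun z => (Gamma (1 + a - z - d))⁻¹ * ∑' m, poch z m * poch d m * β m) c :=
  ((differentiable_inv_Gamma_sub_sub a d).analyticAt c).mul <|
    (growthLE_poch_mul_poch_mul hβ c d).analyticAt_tsum (by linarith) fun m =>
      ((differentiable_poch m).mul_const _).mul_const _

namespace IsBaileyPair

theorem tsum_eq (h : IsBaileyPair a α β) (hα : GrowthLE (pure ()) κ fun _ => α)
    (hβ : GrowthLE (pure ()) ν fun _ m => β m * (m.factorial : ℂ) ^ 2)
    (hleft : κ + 2 * c.re + 2 * d.re - 2 * (1 + a).re < -1) (hright : c.re + d.re + ν < 1) :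
    ∑' r, baileyTerm a c d α r =
      (Gamma (1 + a - c - d))⁻¹ * ∑' m, poch c m * poch d m * β m := by
  refine eq_of_eq_of_re_le (h := (a - d).re) (F := fun c => ∑' r, baileyTerm a c d α r)
    (G := fun c => (Gamma (1 + a - c - d))⁻¹ * ∑' m, poch c m * poch d m * β m)
    (fun z hz => (growthLE_baileyTerm hα a z d).analyticAt_tsum (by linarith)
      (differentiable_baileyTerm a d α))
    (fun z hz => analyticAt_inv_Gamma_mul_tsum hβ a (by linarith)) fun z hz hza => ?_
  refine h.tsum_eq_of_re_nonneg ?_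
    ((growthLE_baileyTerm hα a z d).summable (by linarith) (pure_le_nhds z))
    ((growthLE_poch_mul_poch_mul hβ z d).summable (by linarith) (pure_le_nhds z))
  simp only [sub_re] at hza ⊢
  linarith

theorem tendsto_sum {f : ℕ → ℂ} (h : IsBaileyPair a (fun r => (-1) ^ r * f r) β)
    (hf : RegularGrowth (pure ()) κ fun _ => f)
    (hβ : GrowthLE (pure ()) ν fun _ m => β m * (m.factorial : ℂ) ^ 2)
    (hleft : κ + 2 * c.re + 2 * d.re - 2 * (1 + a).re < 0) (hright : c.re + d.re + ν < 1) :
    Tendsto (fun N => ∑ r ∈ range N, (-1) ^ r * baileyTerm a c d f r) atTop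
      (𝓝 ((Gamma (1 + a - c - d))⁻¹ * ∑' m, poch c m * poch d m * β m)) := by
  have tendsto_alternatingSum (z : ℂ) (hz : z.re ≤ c.re) := (regularGrowth_baileyTerm hf a z
    d).tendsto_sum_neg_one_pow_mul (by linarith) (pure_le_nhds z)
  have continuation : alternatingSum (baileyTerm a c d f) =
      (Gamma (1 + a - c - d))⁻¹ * ∑' m, poch c m * poch d m * β m := by
    refine eq_of_eq_of_re_le (h := min (c.re - 1) (a - d).re)
      (F := fun c => alternatingSum (baileyTerm a c d f))
      (G := fun c => (Gamma (1 + a - c - d))⁻¹ * ∑' m, poch c m * poch d m * β m)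
      (fun z hz => (regularGrowth_baileyTerm hf a z d).analyticAt_alternatingSum (by linarith)
        (differentiable_baileyTerm a d f))
      (fun z hz => analyticAt_inv_Gamma_mul_tsum hβ a (by linarith)) fun z hz hzh => ?_
    obtain ⟨hzc, hza⟩ := lt_min_iff.mp hzh
    have summable_left := ((growthLE_baileyTerm hf.1.neg_one_pow_mul a z d).summable
      (by linarith) (pure_le_nhds z))
    rw [← h.tsum_eq_of_re_nonneg (by simp only [sub_re] at hza ⊢; linarith) summable_left
      ((growthLE_poch_mul_poch_mul hβ z d).summable (by linarith) (pure_le_nhds z))]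
    refine tendsto_nhds_unique (tendsto_alternatingSum z hz) ?_
    simpa only [baileyTerm, mul_assoc] using summable_left.hasSum.tendsto_sum_nat
  exact continuation ▸ tendsto_alternatingSum c le_rfl

end IsBaileyPair

lemma baileyTerm_eq_zero {r : ℕ} (h : poch c r * poch d r = 0) (a : ℂ) (α : ℕ → ℂ) :
    baileyTerm a c d α r = 0 := by
  rw [baileyTerm, pochDivGamma, pochDivGamma, mul_mul_mul_comm, h, zero_mul, mul_zero]

lemma baileyTerm_comm (a c d : ℂ) (α : ℕ → ℂ) : baileyTerm a c d α = baileyTerm a d c α := by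
  funext r
  rw [baileyTerm, baileyTerm, mul_comm (pochDivGamma c _ r)]

namespace IsBaileyPair

theorem tsum_eq_of_isNonposInt (h : IsBaileyPair a α β) (hcd : IsNonposInt c ∨ IsNonposInt d) :
    ∑' r, baileyTerm a c d α r =
      (Gamma (1 + a - c - d))⁻¹ * ∑' m, poch c m * poch d m * β m := by
  wlog hd : IsNonposInt d generalizing c d
  · simpa only [baileyTerm_comm a d, sub_right_comm _ d, mul_comm (poch d _)] using
      this hcd.symm (hcd.resolve_right hd)
  obtain ⟨p, rfl⟩ := hd
  have poch_mul_poch_eq_zero (z : ℂ) {k : ℕ} (hk : k ∉ range (p + 1)) :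
      poch z k * poch (-(p : ℂ)) k = 0 := by
    rw [poch_neg_natCast_eq_zero (by simpa [Nat.lt_succ_iff] using hk), mul_zero]
  have left_eq_zero (z : ℂ) (r : ℕ) (hr : r ∉ range (p + 1)) : baileyTerm a z (-p) α r = 0 :=
    baileyTerm_eq_zero (poch_mul_poch_eq_zero z hr) a α
  have right_eq_zero (z : ℂ) (m : ℕ) (hm : m ∉ range (p + 1)) :
      poch z m * poch (-(p : ℂ)) m * β m = 0 := by
    rw [poch_mul_poch_eq_zero z hm, zero_mul]
  refine eq_of_eq_of_re_le (h := (a - -(p : ℂ)).re) (F := fun z => ∑' r, baileyTerm a z (-p) α r)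
    (G := fun z => (Gamma (1 + a - z - -(p : ℂ)))⁻¹ * ∑' m, poch z m * poch (-(p : ℂ)) m * β m)
    (fun z _ => ?_) (fun z _ => ?_) fun z _ hza => ?_
  · simp only [tsum_eq_sum (left_eq_zero _)]
    exact (Differentiable.fun_sum fun r _ => differentiable_baileyTerm a _ α r).analyticAt z
  · simp only [tsum_eq_sum (right_eq_zero _)]
    exact ((differentiable_inv_Gamma_sub_sub a _).mul (Differentiable.fun_sum fun m _ =>
      ((differentiable_poch m).mul_const _).mul_const _)).analyticAt z
  · refine h.tsum_eq_of_re_nonneg ?_ (summable_of_ne_finset_zero (left_eq_zero z))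
      (summable_of_ne_finset_zero (right_eq_zero z))
    simp only [sub_re] at hza ⊢
    linarith

end IsBaileyPair

end BaileyLemmaContinuation

section Transformation

lemma hasSum_baileyTerm_of_isNonposInt {a c d : ℂ} {α β : ℕ → ℂ} (h : IsBaileyPair a α β)
    (hcd : IsNonposInt c ∨ IsNonposInt d) :
    HasSum (baileyTerm a c d α) ((Gamma (1 + a - c - d))⁻¹ * ∑' m, poch c m * poch d m * β m) := by
  obtain ⟨p, hp⟩ := exists_poch_mul_poch_eq_zero hcd
  rw [← h.tsum_eq_of_isNonposInt hcd]
  refine (summable_of_ne_finset_zero (s := range (p + 1)) fun r hr => ?_).hasSum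
  exact baileyTerm_eq_zero (hp r (by simpa [Nat.lt_succ_iff] using hr)) a α

/-- The second member shared, up to constant factors, by the two Bailey pairs behind the
transformation. -/
def commonBeta (n : ℂ) (m : ℕ) : ℂ :=
  poch (n + 1 / 2) m / (poch (2 * n + 3 / 2) m * poch (2 * n + 1) m * (m.factorial : ℂ))

/-- The first member, up to sign, of the Bailey pair relative to `3 * n + 1` which produces the
series at `-1`. -/
def alphaL (n : ℂ) (r : ℕ) : ℂ :=
  (3 * n + 1 + 2 * r) * (poch (3 * n + 1) r / (r.factorial : ℂ)) *
    (poch (n + 1 / 2) r / poch (2 * n + 3 / 2) r) * (poch (n + 1) r / poch (2 * n + 1) r)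

/-- The first member of the Bailey pair relative to `2 * (2 * n + 1)` which produces the series
at `1`. -/
def alphaR (n : ℂ) (r : ℕ) : ℂ :=
  if Even r then (2 * n + 1 + r) * (poch (2 * n + 1) (r / 2) / ((r / 2).factorial : ℂ)) else 0

variable {n c d : ℂ}

lemma isBaileyPair_alphaL (h₁ : ¬ IsNonposInt (2 * n + 1)) (h₂ : ¬ IsNonposInt (2 * n + 3 / 2)) :
    IsBaileyPair (3 * n + 1) (fun r => (-1) ^ r * alphaL n r)
      (fun m => (3 * n + 1) * (Gamma (1 + (3 * n + 1)))⁻¹ * commonBeta n m) := by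
  have lower₂ : 1 + (3 * n + 1) - (n + 1 / 2) = 2 * n + 3 / 2 := by ring
  have lower₁ : 1 + (3 * n + 1) - (n + 1) = 2 * n + 1 := by ring
  have upper : 2 * n + 3 / 2 - (n + 1) = n + 1 / 2 := by ring
  have pair := isBaileyPair_veryWellPoised (3 * n + 1) (n + 1 / 2) (n + 1)
  rw [lower₂, lower₁, upper] at pair
  exact pair (poch_ne_zero h₂) (poch_ne_zero h₁)

lemma isBaileyPair_alphaR (h₁ : ¬ IsNonposInt (2 * n + 1)) (h₂ : ¬ IsNonposInt (2 * n + 3 / 2)) :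
    IsBaileyPair (2 * (2 * n + 1)) (alphaR n)
      (fun m => (2 * n + 1) * (Gamma (1 + 2 * (2 * n + 1)))⁻¹ * commonBeta n m) := by
  have ne_zero (k : ℕ) : 2 * (2 * n + 1) + (k : ℂ) ≠ 0 := by
    intro hk
    obtain ⟨j, rfl | rfl⟩ := Nat.even_or_odd' k <;> push_cast at hk
    · exact h₁ ⟨j, by linear_combination hk / 2⟩
    · exact h₂ ⟨j, by linear_combination hk / 2⟩
  have pair := isBaileyPair_even (2 * n + 1) ne_zero
  rw [show (2 * n + 1) / 2 = n + 1 / 2 by ring,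
    show 2 * n + 1 + 1 / 2 = 2 * n + 3 / 2 by ring] at pair
  simp only [mul_comm (poch (2 * n + 1) _) (poch (2 * n + 3 / 2) _)] at pair
  exact pair

lemma growthLE_commonBeta (h₁ : ¬ IsNonposInt (2 * n + 1)) (h₂ : ¬ IsNonposInt (2 * n + 3 / 2))
    (x : ℂ) : GrowthLE (pure ()) (-3 * n.re - 1)
      fun _ m => x * commonBeta n m * (m.factorial : ℂ) ^ 2 := by
  have growth := ((regularGrowth_poch_div_poch (pure ()) (n + 1 / 2) h₁).1.mul
    (regularGrowth_poch_div_poch (pure ()) 1 h₂).1).const_mul x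
  convert growth using 3 with _ m
  · norm_num
    ring
  · have := poch_ne_zero h₁ m
    have := poch_ne_zero h₂ m
    have := natCast_factorial_ne_zero m
    rw [commonBeta, poch_one]
    field_simp

lemma regularGrowth_alphaL (h₁ : ¬ IsNonposInt (2 * n + 1)) (h₂ : ¬ IsNonposInt (2 * n + 3 / 2)) :
    RegularGrowth (pure ()) n.re fun _ => alphaL n := by
  have growth := (((RegularGrowth.linear (l := pure ()) (3 * n + 1)).mul
    (regularGrowth_poch_div_factorial (pure ()) (3 * n + 1))).mul
      (regularGrowth_poch_div_poch (pure ()) (n + 1 / 2) h₂)).mul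
        (regularGrowth_poch_div_poch (pure ()) (n + 1) h₁)
  have order : 1 + ((3 * n + 1).re - 1) + (n + 1 / 2 - (2 * n + 3 / 2)).re +
      (n + 1 - (2 * n + 1)).re = n.re := by
    norm_num
    ring
  rwa [order] at growth

lemma growthLE_alphaR : GrowthLE (pure ()) (2 * n.re + 1) fun _ => alphaR n := by
  have linear := ((GrowthLE.of_tendsto (l := pure ()) (tendsto_const_nhds (x := 2 * n + 1))).mono
    zero_le_one).add .natCast
  have growth := linear.mul (regularGrowth_poch_div_factorial (pure ()) (2 * n + 1)).1.ite_even
  have order : 1 + ((2 * n + 1).re - 1) = 2 * n.re + 1 := by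
    norm_num
    ring
  rw [order] at growth
  convert growth using 3 with _ r
  rw [alphaR, mul_ite, mul_zero]

lemma tsum_poch_mul_poch_mul_const_mul (c d x : ℂ) (β : ℕ → ℂ) :
    ∑' m, poch c m * poch d m * (x * β m) = x * ∑' m, poch c m * poch d m * β m := by
  rw [← tsum_mul_left]
  exact tsum_congr fun m => mul_left_comm _ _ _

lemma hasSum_baileyTerm_alphaR (h₁ : ¬ IsNonposInt (2 * n + 1))
    (h₂ : ¬ IsNonposInt (2 * n + 3 / 2))
    (h : (0 < (5 * n + 4 - 2 * c - 2 * d).re ∧ 0 < (3 * n + 2 - c - d).re) ∨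
      IsNonposInt c ∨ IsNonposInt d) :
    HasSum (baileyTerm (2 * (2 * n + 1)) c d (alphaR n))
      ((Gamma (1 + 2 * (2 * n + 1) - c - d))⁻¹ * ((2 * n + 1) *
        (Gamma (1 + 2 * (2 * n + 1)))⁻¹ * ∑' m, poch c m * poch d m * commonBeta n m)) := by
  rw [← tsum_poch_mul_poch_mul_const_mul]
  have pair := isBaileyPair_alphaR h₁ h₂
  rcases h with ⟨_, h⟩ | h
  · norm_num at h
    rw [← pair.tsum_eq growthLE_alphaR (growthLE_commonBeta h₁ h₂ _) (by norm_num; linarith)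
      (by linarith)]
    exact ((growthLE_baileyTerm growthLE_alphaR _ c d).summable (by norm_num; linarith)
      (pure_le_nhds c)).hasSum
  · exact hasSum_baileyTerm_of_isNonposInt pair h

lemma tendsto_sum_baileyTerm_alphaL (h₁ : ¬ IsNonposInt (2 * n + 1))
    (h₂ : ¬ IsNonposInt (2 * n + 3 / 2))
    (h : (0 < (5 * n + 4 - 2 * c - 2 * d).re ∧ 0 < (3 * n + 2 - c - d).re) ∨
      IsNonposInt c ∨ IsNonposInt d) :
    Tendsto (fun N => ∑ r ∈ range N, (-1) ^ r * baileyTerm (3 * n + 1) c d (alphaL n) r) atTop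
      (𝓝 ((Gamma (1 + (3 * n + 1) - c - d))⁻¹ * ((3 * n + 1) *
        (Gamma (1 + (3 * n + 1)))⁻¹ * ∑' m, poch c m * poch d m * commonBeta n m))) := by
  rw [← tsum_poch_mul_poch_mul_const_mul]
  have pair := isBaileyPair_alphaL h₁ h₂
  rcases h with ⟨h, h'⟩ | h
  · norm_num at h h'
    exact pair.tendsto_sum (regularGrowth_alphaL h₁ h₂) (growthLE_commonBeta h₁ h₂ _)
      (by norm_num; linarith) (by linarith)
  · simpa only [baileyTerm, mul_assoc] using
      (hasSum_baileyTerm_of_isNonposInt pair h).tendsto_sum_nat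

lemma poch_add_one_div_poch {x : ℂ} (hx : ¬ IsNonposInt x) (k : ℕ) :
    poch (x + 1) k / poch x k = (x + k) / x := by
  have x_ne : x ≠ 0 := fun h => hx ⟨0, by simpa using h⟩
  rw [div_eq_div_iff (poch_ne_zero hx k) x_ne]
  linear_combination poch_succ x k - poch_succ_left x k

lemma poch_two_mul (x : ℂ) (k : ℕ) :
    poch x (2 * k) = 4 ^ k * (poch (x / 2) k * poch (x / 2 + 1 / 2) k) := by
  induction k with
  | zero => simp
  | succ k ih =>
    rw [mul_add_one, poch_succ, poch_succ, ih, poch_succ, poch_succ]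
    push_cast
    ring

lemma not_isNonposInt_of_half {x : ℂ} (h : ¬ IsNonposInt (x / 2))
    (h' : ¬ IsNonposInt (x / 2 + 1 / 2)) : ¬ IsNonposInt x := by
  rintro ⟨m, hm⟩
  obtain ⟨j, rfl | rfl⟩ := Nat.even_or_odd' m <;> push_cast at hm
  · exact h ⟨j, by linear_combination hm / 2⟩
  · exact h' ⟨j, by linear_combination hm / 2⟩

lemma mul_hypTerm_L_eq (h₀ : ¬ IsNonposInt (3 * n / 2 + 1 / 2)) (c d : ℂ) (k : ℕ) :
    (3 * n + 1) * hypTerm (upperL n c d) (lowerL n c d) (-1) k =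
      (-1) ^ k * (alphaL n k * (poch c k / poch (3 * n + 2 - c) k *
        (poch d k / poch (3 * n + 2 - d) k))) := by
  have ne : 3 * n + 1 ≠ 0 := fun h => h₀ ⟨0, by push_cast; linear_combination h / 2⟩
  have ratio : (3 * n + 1) * (poch (3 * n / 2 + 3 / 2) k / poch (3 * n / 2 + 1 / 2) k) =
      3 * n + 1 + 2 * k := by
    rw [show 3 * n / 2 + 3 / 2 = 3 * n / 2 + 1 / 2 + 1 by ring, poch_add_one_div_poch h₀,
      show 3 * n / 2 + 1 / 2 = (3 * n + 1) / 2 by ring]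
    field_simp
  have factored : hypTerm (upperL n c d) (lowerL n c d) (-1) k =
      (poch (3 * n / 2 + 3 / 2) k / poch (3 * n / 2 + 1 / 2) k) * ((-1) ^ k *
        (poch (3 * n + 1) k / (k.factorial : ℂ)) *
        (poch (n + 1 / 2) k / poch (2 * n + 3 / 2) k) * (poch (n + 1) k / poch (2 * n + 1) k) *
        (poch c k / poch (3 * n + 2 - c) k) * (poch d k / poch (3 * n + 2 - d) k)) := by
    simp only [hypTerm, upperL, lowerL, List.map_cons, List.map_nil, List.prod_cons,
      List.prod_nil, poch, div_eq_mul_inv, mul_inv, mul_one]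
    ring
  rw [factored, ← mul_assoc, ratio, alphaL]
  ring

lemma hypTerm_L_eq_baileyTerm (h₀ : ¬ IsNonposInt (3 * n / 2 + 1 / 2))
    (hc : ¬ IsNonposInt (3 * n + 2 - c)) (hd : ¬ IsNonposInt (3 * n + 2 - d)) (k : ℕ) :
    hypTerm (upperL n c d) (lowerL n c d) (-1) k =
      Gamma (3 * n + 2 - c) * Gamma (3 * n + 2 - d) / (3 * n + 1) *
        ((-1) ^ k * baileyTerm (3 * n + 1) c d (alphaL n) k) := by
  have ne : 3 * n + 1 ≠ 0 := fun h => h₀ ⟨0, by push_cast; linear_combination h / 2⟩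
  rw [div_mul_eq_mul_div, eq_div_iff ne, mul_comm, mul_hypTerm_L_eq h₀, poch_div_poch_eq c hc,
    poch_div_poch_eq d hd, baileyTerm, show 1 + (3 * n + 1) = 3 * n + 2 by ring]
  ring

lemma summable_hypTerm_L (hL : ∀ b ∈ lowerL n c d, ¬ IsNonposInt b)
    (h : 0 < (5 * n + 3 - 2 * c - 2 * d).re) :
    Summable (hypTerm (upperL n c d) (lowerL n c d) (-1)) := by
  simp only [lowerL, List.forall_mem_cons, List.not_mem_nil, false_imp_iff, implies_true,
    and_true] at hL
  obtain ⟨l₀, l₂, l₁, hc, hd⟩ := hL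
  norm_num at h
  have growth := growthLE_baileyTerm (regularGrowth_alphaL l₁ l₂).1.neg_one_pow_mul
    (3 * n + 1) c d
  have summable := (growth.summable (by norm_num; linarith) (pure_le_nhds c)).mul_left
    (Gamma (3 * n + 2 - c) * Gamma (3 * n + 2 - d) / (3 * n + 1))
  refine summable.congr fun k => ?_
  rw [hypTerm_L_eq_baileyTerm l₀ hc hd, baileyTerm, baileyTerm, mul_assoc ((-1) ^ k)]

lemma poch_two_mul_div_poch (e c : ℂ) (k : ℕ) :
    poch c (2 * k) / poch e (2 * k) =
      poch (c / 2) k / poch (e / 2) k * (poch (c / 2 + 1 / 2) k / poch (e / 2 + 1 / 2) k) := by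
  rw [poch_two_mul, poch_two_mul, mul_div_mul_left _ _ (pow_ne_zero k (by norm_num)),
    mul_div_mul_comm]

lemma mul_hypTerm_R_eq (h₀ : ¬ IsNonposInt (n + 1 / 2)) (c d : ℂ) (k : ℕ) :
    (2 * n + 1) * hypTerm (upperR n c d) (lowerR n c d) 1 k =
      alphaR n (2 * k) * (poch c (2 * k) / poch (4 * n + 3 - c) (2 * k) *
        (poch d (2 * k) / poch (4 * n + 3 - d) (2 * k))) := by
  have ne : 2 * n + 1 ≠ 0 := fun h => h₀ ⟨0, by push_cast; linear_combination h / 2⟩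
  have ratio : (2 * n + 1) * (poch (n + 3 / 2) k / poch (n + 1 / 2) k) = 2 * n + 1 + 2 * k := by
    rw [show n + 3 / 2 = n + 1 / 2 + 1 by ring, poch_add_one_div_poch h₀,
      show n + 1 / 2 = (2 * n + 1) / 2 by ring]
    field_simp
  have bisected (c : ℂ) : poch c (2 * k) / poch (4 * n + 3 - c) (2 * k) =
      poch (c / 2) k / poch (2 * n + 3 / 2 - c / 2) k *
        (poch (c / 2 + 1 / 2) k / poch (2 * n + 2 - c / 2) k) := by
    rw [poch_two_mul_div_poch]
    ring_nf
  have factored : hypTerm (upperR n c d) (lowerR n c d) 1 k =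
      (poch (n + 3 / 2) k / poch (n + 1 / 2) k) * ((poch (2 * n + 1) k / (k.factorial : ℂ)) *
        (poch c (2 * k) / poch (4 * n + 3 - c) (2 * k)) *
        (poch d (2 * k) / poch (4 * n + 3 - d) (2 * k))) := by
    rw [bisected, bisected]
    simp only [hypTerm, upperR, lowerR, List.map_cons, List.map_nil, List.prod_cons,
      List.prod_nil, one_pow, poch, div_eq_mul_inv, mul_inv, mul_one, one_mul]
    ring
  rw [factored, ← mul_assoc, ratio, alphaR, if_pos (even_two_mul k),
    Nat.mul_div_cancel_left k two_pos]
  push_cast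
  ring

lemma hypTerm_R_eq_baileyTerm (h₀ : ¬ IsNonposInt (n + 1 / 2))
    (hc : ¬ IsNonposInt (4 * n + 3 - c)) (hd : ¬ IsNonposInt (4 * n + 3 - d)) (k : ℕ) :
    hypTerm (upperR n c d) (lowerR n c d) 1 k =
      Gamma (4 * n + 3 - c) * Gamma (4 * n + 3 - d) / (2 * n + 1) *
        baileyTerm (2 * (2 * n + 1)) c d (alphaR n) (2 * k) := by
  have ne : 2 * n + 1 ≠ 0 := fun h => h₀ ⟨0, by push_cast; linear_combination h / 2⟩
  rw [div_mul_eq_mul_div, eq_div_iff ne, mul_comm, mul_hypTerm_R_eq h₀, poch_div_poch_eq c hc,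
    poch_div_poch_eq d hd, baileyTerm, show 1 + 2 * (2 * n + 1) = 4 * n + 3 by ring]
  ring

lemma hasSum_hypTerm_R (h₀ : ¬ IsNonposInt (n + 1 / 2))
    (hc : ¬ IsNonposInt (4 * n + 3 - c)) (hd : ¬ IsNonposInt (4 * n + 3 - d)) {s : ℂ}
    (h : HasSum (baileyTerm (2 * (2 * n + 1)) c d (alphaR n)) s) :
    HasSum (hypTerm (upperR n c d) (lowerR n c d) 1)
      (Gamma (4 * n + 3 - c) * Gamma (4 * n + 3 - d) / (2 * n + 1) * s) := by
  have odd_eq_zero (r : ℕ) (hr : r ∉ Set.range fun k : ℕ => 2 * k) :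
      baileyTerm (2 * (2 * n + 1)) c d (alphaR n) r = 0 := by
    have not_even : ¬ Even r := fun even => hr (even.two_dvd.imp fun _ => Eq.symm)
    rw [baileyTerm, alphaR, if_neg not_even, zero_mul]
  have even_sum := ((mul_right_injective₀ two_ne_zero).hasSum_iff odd_eq_zero).mpr h
  simpa only [Function.comp_def, ← hypTerm_R_eq_baileyTerm h₀ hc hd] using
    even_sum.mul_left (Gamma (4 * n + 3 - c) * Gamma (4 * n + 3 - d) / (2 * n + 1))

/-- The quotient of Gamma functions relating the two series of the transformation. -/
def gammaFactor (n c d : ℂ) : ℂ :=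
  Gamma (4 * n + 3) * Gamma (3 * n + 2 - c) * Gamma (3 * n + 2 - d) * Gamma (4 * n + 3 - c - d) /
    (Gamma (3 * n + 2) * Gamma (4 * n + 3 - c) * Gamma (4 * n + 3 - d) * Gamma (3 * n + 2 - c - d))

theorem hypergeometric_transformation (hL : ∀ b ∈ lowerL n c d, ¬ IsNonposInt b)
    (hR : ∀ b ∈ lowerR n c d, ¬ IsNonposInt b) (hcd : ¬ IsNonposInt (4 * n + 3 - c - d))
    (h : (0 < (5 * n + 4 - 2 * c - 2 * d).re ∧ 0 < (3 * n + 2 - c - d).re) ∨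
      IsNonposInt c ∨ IsNonposInt d) :
    ∃ s : ℂ, HasSum (hypTerm (upperR n c d) (lowerR n c d) 1) s ∧
      HasHypSum (upperL n c d) (lowerL n c d) (-1) (gammaFactor n c d * s) := by
  simp only [lowerL, List.forall_mem_cons, List.not_mem_nil, false_imp_iff, implies_true,
    and_true] at hL
  simp only [lowerR, List.forall_mem_cons, List.not_mem_nil, false_imp_iff, implies_true,
    and_true] at hR
  obtain ⟨l₀, l₂, l₁, hcL, hdL⟩ := hL
  obtain ⟨r₀, c₂, c₁, d₂, d₁⟩ := hR
  have hcR : ¬ IsNonposInt (4 * n + 3 - c) :=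
    not_isNonposInt_of_half (by convert c₁ using 2; ring) (by convert c₂ using 2; ring)
  have hdR : ¬ IsNonposInt (4 * n + 3 - d) :=
    not_isNonposInt_of_half (by convert d₁ using 2; ring) (by convert d₂ using 2; ring)
  have h₄ : ¬ IsNonposInt (4 * n + 3) := by
    refine not_isNonposInt_of_half (by convert l₂ using 2; ring) fun ⟨m, hm⟩ => l₁ ⟨m + 1, ?_⟩
    push_cast
    linear_combination hm
  have sumR := hasSum_hypTerm_R r₀ hcR hdR (hasSum_baileyTerm_alphaR l₁ l₂ h)
  refine ⟨_, sumR, ?_⟩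
  have sumL := (tendsto_sum_baileyTerm_alphaL l₁ l₂ h).const_mul
    (Gamma (3 * n + 2 - c) * Gamma (3 * n + 2 - d) / (3 * n + 1))
  simp only [mul_sum, ← hypTerm_L_eq_baileyTerm l₀ hcL hdL] at sumL
  have ne₃ : 3 * n + 1 ≠ 0 := fun h => l₀ ⟨0, by push_cast; linear_combination h / 2⟩
  have ne₂ : 2 * n + 1 ≠ 0 := fun h => l₁ ⟨0, by simpa using h⟩
  have := Gamma_ne_zero_of_not_isNonposInt hcR
  have := Gamma_ne_zero_of_not_isNonposInt hdR
  have := Gamma_ne_zero_of_not_isNonposInt h₄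
  have := Gamma_ne_zero_of_not_isNonposInt hcd
  rw [HasHypSum]
  convert sumL using 2
  rw [gammaFactor, show 1 + 2 * (2 * n + 1) = 4 * n + 3 by ring,
    show 1 + (3 * n + 1) = 3 * n + 2 by ring]
  generalize 2 * n + 1 = x, 3 * n + 1 = y at *
  field_simp

end Transformation

section Catalan

lemma prod_Icc_add_eq_poch {R : Type*} [CommRing R] (x : R) (m : ℕ) :
    ∏ j ∈ Icc 1 m, (x + j) = poch (x + 1) m := by
  rw [← prod_range_add_eq_poch, ← Ico_add_one_right_eq_Icc, prod_Ico_eq_prod_range]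
  exact prod_congr rfl fun j _ => by push_cast; ring

lemma prod_Icc_sub_eq_poch {R : Type*} [CommRing R] (m k : ℕ) :
    ∏ j ∈ Icc 1 m, (((m + k : ℕ) : R) + 1 - j) = poch (k + 1 : R) m := by
  rw [← add_zero (k + 1 : R), ← prod_range_sub_add_eq_poch, ← Ico_add_one_right_eq_Icc,
    prod_Ico_eq_prod_range]
  exact prod_congr rfl fun j _ => by push_cast; ring

lemma poch_add_natCast {x : ℂ} (hx : ¬ IsNonposInt x) (m k : ℕ) :
    poch (x + k) m = poch x m * poch (x + m) k / poch x k := by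
  rw [eq_div_iff (poch_ne_zero hx k), mul_comm, ← poch_add, ← poch_add, add_comm]

lemma poch_natCast_add_one (m k : ℕ) :
    poch (k + 1 : ℂ) m = m.factorial * poch (m + 1 : ℂ) k / k.factorial := by
  rw [add_comm, poch_add_natCast not_isNonposInt_one, poch_one, poch_one, add_comm]

lemma not_isNonposInt_of_re_pos {x : ℂ} (h : 0 < x.re) : ¬ IsNonposInt x := by
  rintro ⟨m, rfl⟩
  rw [neg_re, natCast_re, neg_pos] at h
  exact h.not_ge m.cast_nonneg

lemma not_isNonposInt_mul_natCast_add (p m : ℕ) {x : ℂ} (hx : 0 < x.re) :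
    ¬ IsNonposInt (p * m + x) := by
  refine not_isNonposInt_of_re_pos ?_
  rw [add_re, ← Nat.cast_mul, natCast_re]
  positivity

/-- The term at `t = n` of the first family, up to which all terms vanish. -/
def catScale (n : ℕ) : ℂ :=
  (3 * n + 1) * (n.factorial ^ 2 * poch (2 * n + 1 : ℂ) n) / poch (n + 1 / 2 : ℂ) (n + 1) ^ 3

/-- The term at `t = n + 1` of the second family, up to which all terms vanish. -/
def catScale' (n : ℕ) : ℂ :=
  4 ^ (n + 1) * ((2 * n + 1) * ((2 * n + 1).factorial * (2 * n).factorial)) /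
    poch (n + 1 / 2 : ℂ) (2 * n + 2) ^ 2

variable (n k : ℕ)

lemma catTerm_add_eq_poch : ((catTerm n (n + k) : ℝ) : ℂ) =
    (3 * n + 1 + 2 * k) * (n.factorial * poch (k + 1 : ℂ) n * poch (2 * n + 1 + k : ℂ) n /
      poch (n + 1 / 2 + k : ℂ) (n + 1) ^ 3) * (-1) ^ k := by
  have upper : ((∏ j ∈ Icc 1 n, (((n + k : ℕ) : ℝ) + 1 - j) : ℝ) : ℂ) = poch (k + 1 : ℂ) n := by
    rw [← prod_Icc_sub_eq_poch]
    push_cast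
    rfl
  have upper' : ((∏ j ∈ Icc 1 n, (((n + k : ℕ) : ℝ) + n + j) : ℝ) : ℂ) =
      poch (2 * n + 1 + k : ℂ) n := by
    rw [show (2 * n + 1 + k : ℂ) = n + k + n + 1 by ring, ← prod_Icc_add_eq_poch]
    push_cast
    rfl
  have lower : ((∏ j ∈ range (n + 1), (((n + k : ℕ) : ℝ) + j + 1 / 2) : ℝ) : ℂ) =
      poch (n + 1 / 2 + k : ℂ) (n + 1) := by
    rw [← prod_range_add_eq_poch]
    push_cast
    exact prod_congr rfl fun j _ => by ring
  have sign : (-1 : ℂ) ^ (n + (n + k)) = (-1) ^ k := by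
    rw [← add_assoc, pow_add, Even.neg_one_pow ⟨n, rfl⟩, one_mul]
  rw [catTerm, prod_pow, ofReal_mul, ofReal_mul, ofReal_div, ofReal_mul, ofReal_mul, ofReal_pow,
    upper, upper', lower]
  push_cast
  rw [sign]
  ring

lemma catTerm'_add_eq_poch : ((catTerm' n (n + k + 1) : ℝ) : ℂ) =
    4 ^ (n + 1) * ((2 * n + 1 + 2 * k) * ((2 * n + 1).factorial * poch (k + 1 : ℂ) (2 * n) /
      poch (n + 1 / 2 + (2 * k : ℕ) : ℂ) (2 * n + 2) ^ 2)) := by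
  have upper : ((∏ j ∈ range (2 * n), (((n + k + 1 : ℕ) : ℝ) - n + j) : ℝ) : ℂ) =
      poch (k + 1 : ℂ) (2 * n) := by
    rw [← prod_range_add_eq_poch]
    push_cast
    exact prod_congr rfl fun j _ => by ring
  have lower : ((∏ j ∈ range (2 * n + 2), (2 * ((n + k + 1 : ℕ) : ℝ) - n - 3 / 2 + j) : ℝ) : ℂ) =
      poch (n + 1 / 2 + (2 * k : ℕ) : ℂ) (2 * n + 2) := by
    rw [← prod_range_add_eq_poch]
    push_cast
    exact prod_congr rfl fun j _ => by ring
  have pow_four : (2 : ℂ) ^ (2 * (n + 1)) = 4 ^ (n + 1) := by rw [pow_mul]; norm_num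
  rw [catTerm', prod_pow, ofReal_mul, ofReal_mul, ofReal_div, ofReal_mul, ofReal_pow _ 2, upper,
    lower]
  push_cast
  rw [pow_four]
  ring

lemma catTerm_add_eq : ((catTerm n (n + k) : ℝ) : ℂ) = catScale n *
    hypTerm (upperL n (n + 1 / 2) (n + 1 / 2)) (lowerL n (n + 1 / 2) (n + 1 / 2)) (-1) k := by
  have shift := poch_add_natCast (not_isNonposInt_mul_natCast_add 2 n (x := 1) (by simp)) n k
  have shift' := poch_add_natCast (not_isNonposInt_mul_natCast_add 1 n (x := 1 / 2) (by norm_num))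
    (n + 1) k
  have hyp := mul_hypTerm_L_eq (n := n) (not_isNonposInt_of_re_pos (by norm_num; positivity))
    (n + 1 / 2) (n + 1 / 2) k
  rw [alphaL, show 3 * (n : ℂ) + 2 - (n + 1 / 2) = 2 * n + 3 / 2 by ring] at hyp
  push_cast at shift shift'
  rw [show 2 * (n : ℂ) + 1 + n = 3 * n + 1 by ring] at shift
  rw [one_mul, show (n : ℂ) + 1 / 2 + (n + 1) = 2 * n + 3 / 2 by ring] at shift'
  rw [catTerm_add_eq_poch, poch_natCast_add_one, shift, shift', catScale, div_pow,
    div_div_eq_mul_div]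
  linear_combination (-n.factorial ^ 2 * poch (2 * n + 1 : ℂ) n /
    poch (n + 1 / 2 : ℂ) (n + 1) ^ 3) * hyp

lemma catTerm'_add_eq : ((catTerm' n (n + k + 1) : ℝ) : ℂ) = catScale' n *
    hypTerm (upperR n (n + 1 / 2) (n + 1 / 2)) (lowerR n (n + 1 / 2) (n + 1 / 2)) 1 k := by
  have shift := poch_add_natCast (not_isNonposInt_mul_natCast_add 1 n (x := 1 / 2) (by norm_num))
    (2 * n + 2) (2 * k)
  have hyp := mul_hypTerm_R_eq (n := n) (not_isNonposInt_of_re_pos (by norm_num; positivity))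
    (n + 1 / 2) (n + 1 / 2) k
  rw [alphaR, if_pos (even_two_mul k), Nat.mul_div_cancel_left k two_pos,
    show 4 * (n : ℂ) + 3 - (n + 1 / 2) = 3 * n + 5 / 2 by ring] at hyp
  push_cast at shift hyp
  rw [one_mul, show (n : ℂ) + 1 / 2 + (2 * n + 2) = 3 * n + 5 / 2 by ring] at shift
  rw [catTerm'_add_eq_poch, poch_natCast_add_one]
  push_cast
  rw [shift, catScale', div_pow, div_div_eq_mul_div]
  linear_combination (-4 ^ (n + 1) * ((2 * n + 1).factorial * (2 * n).factorial) /
    poch (n + 1 / 2 : ℂ) (2 * n + 2) ^ 2) * hyp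

variable {n k}

lemma catTerm_eq_zero {t : ℕ} (h : t < n) : catTerm n t = 0 := by
  have prod_eq_zero : ∏ j ∈ Icc 1 n, ((t : ℝ) + 1 - j) = 0 :=
    prod_eq_zero (mem_Icc.mpr ⟨t.succ_pos, h⟩) (by push_cast; ring)
  rw [catTerm, prod_eq_zero, mul_zero, zero_mul, zero_div, mul_zero, zero_mul]

lemma catTerm'_eq_zero {t : ℕ} (h : t < n) : catTerm' n (t + 1) = 0 := by
  have prod_eq_zero : ∏ j ∈ range (2 * n), (((t + 1 : ℕ) : ℝ) - n + j) = 0 := by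
    refine prod_eq_zero (i := n - (t + 1)) (mem_range.mpr (by omega)) ?_
    rw [Nat.cast_sub (Nat.succ_le_of_lt h)]
    ring
  rw [catTerm', prod_eq_zero, mul_zero, zero_div, mul_zero, mul_zero]

lemma hasSum_re_of_hasSum_ofReal_add {f : ℕ → ℝ} {z : ℂ} (hf : ∀ t < n, f t = 0)
    (hz : HasSum (fun k => (f (n + k) : ℂ)) z) : HasSum f z.re := by
  refine ((add_right_injective n).hasSum_iff fun t ht => hf t ?_).mp (hasSum_re hz)
  by_contra! le
  exact ht ⟨t - n, Nat.add_sub_cancel' le⟩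

variable (n)

lemma factorial_two_mul_eq_poch (m : ℕ) :
    ((2 * m).factorial : ℂ) = 4 ^ m * (poch (1 / 2 : ℂ) m * m.factorial) := by
  rw [← poch_one, poch_two_mul, ← poch_one]
  norm_num

lemma factorial_four_mul_add_two_mul_factorial :
    ((4 * n + 2).factorial : ℂ) * n.factorial =
      4 ^ (n + 1) * ((2 * n + 1).factorial * (2 * n).factorial * poch (n + 1 / 2 : ℂ) (n + 1)) := by
  have poch_half : poch (1 / 2 : ℂ) (n + (n + 1)) =
      poch (1 / 2 : ℂ) n * poch (n + 1 / 2 : ℂ) (n + 1) := by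
    rw [poch_add, add_comm (1 / 2 : ℂ)]
  rw [show 4 * n + 2 = 2 * (2 * n + 1) by ring, factorial_two_mul_eq_poch (2 * n + 1),
    factorial_two_mul_eq_poch n, show 2 * n + 1 = n + (n + 1) by ring, poch_half]
  ring

lemma gammaFactor_half : gammaFactor n (n + 1 / 2) (n + 1 / 2) =
    (4 * n + 2).factorial * (2 * n + 1).factorial * poch (n + 1 / 2 : ℂ) (n + 1) ^ 2 /
      ((3 * n + 1).factorial * n.factorial * poch (n + 1 / 2 : ℂ) (2 * n + 2) ^ 2) := by
  have nonpos : ¬ IsNonposInt (n + 1 / 2 : ℂ) :=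
    not_isNonposInt_of_re_pos (by norm_num; positivity)
  have Gamma_ne := Gamma_ne_zero_of_not_isNonposInt nonpos
  have Gamma_eq_factorial {x : ℂ} (m : ℕ) (hx : x = m + 1) : Gamma x = m.factorial := by
    rw [hx, Gamma_nat_eq_factorial]
  have Gamma_eq_poch {x : ℂ} (m : ℕ) (hx : x = n + 1 / 2 + m) :
      Gamma x = poch (n + 1 / 2 : ℂ) m * Gamma (n + 1 / 2) := by
    rw [hx, poch, ← Gamma_add_nat_div_Gamma_eq _ fun j h => nonpos ⟨j, h⟩,
      div_mul_cancel₀ _ Gamma_ne]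
  rw [gammaFactor, Gamma_eq_factorial (x := 4 * n + 3) (4 * n + 2) (by push_cast; ring),
    Gamma_eq_factorial (x := 4 * n + 3 - _ - _) (2 * n + 1) (by push_cast; ring),
    Gamma_eq_factorial (x := 3 * n + 2) (3 * n + 1) (by push_cast; ring),
    Gamma_eq_factorial (x := 3 * n + 2 - _ - _) n (by ring),
    Gamma_eq_poch (x := 3 * n + 2 - _) (n + 1) (by push_cast; ring),
    Gamma_eq_poch (x := 4 * n + 3 - _) (2 * n + 2) (by push_cast; ring)]
  generalize (n + 1 / 2 : ℂ) = x at Gamma_ne ⊢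
  field_simp

lemma catScale_mul_gammaFactor :
    catScale n * gammaFactor n (n + 1 / 2) (n + 1 / 2) = catScale' n := by
  have nonpos : ¬ IsNonposInt (n + 1 / 2 : ℂ) :=
    not_isNonposInt_of_re_pos (by norm_num; positivity)
  have factorial_three : ((3 * n + 1).factorial : ℂ) =
      (3 * n + 1) * ((2 * n).factorial * poch (2 * n + 1 : ℂ) n) := by
    rw [Nat.factorial_succ, show 3 * n = n + 2 * n by ring, Nat.cast_mul,
      factorial_add_eq_mul_poch]
    push_cast
    ring
  have factorial_odd : ((2 * n + 1).factorial : ℂ) = (2 * n + 1) * (2 * n).factorial := by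
    rw [Nat.factorial_succ]
    push_cast
    ring
  obtain ⟨three_ne, two_ne, shifted_ne⟩ :
      (3 * n + 1 : ℂ) ≠ 0 ∧ ((2 * n).factorial : ℂ) ≠ 0 ∧ poch (2 * n + 1 : ℂ) n ≠ 0 := by
    simpa only [factorial_three, mul_ne_zero_iff] using natCast_factorial_ne_zero (3 * n + 1)
  have factorial_ne := natCast_factorial_ne_zero n
  have poch_ne := poch_ne_zero nonpos (n + 1)
  have poch_ne' := poch_ne_zero nonpos (2 * n + 2)
  rw [catScale, gammaFactor_half, factorial_three, catScale',
    eq_div_of_mul_eq factorial_ne (factorial_four_mul_add_two_mul_factorial n), factorial_odd]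
  generalize (n + 1 / 2 : ℂ) = x, (2 * n + 1 : ℂ) = y, (3 * n + 1 : ℂ) = z at *
  field_simp

lemma not_isNonposInt_of_mem_lowerL :
    ∀ b ∈ lowerL n (n + 1 / 2) (n + 1 / 2), ¬ IsNonposInt b := by
  have := n.cast_nonneg (α := ℝ)
  simp only [lowerL, List.forall_mem_cons, List.not_mem_nil, false_imp_iff, implies_true, and_true]
  refine ⟨?_, ?_, ?_, ?_, ?_⟩ <;> refine not_isNonposInt_of_re_pos ?_ <;> norm_num <;> linarith

lemma not_isNonposInt_of_mem_lowerR :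
    ∀ b ∈ lowerR n (n + 1 / 2) (n + 1 / 2), ¬ IsNonposInt b := by
  have := n.cast_nonneg (α := ℝ)
  simp only [lowerR, List.forall_mem_cons, List.not_mem_nil, false_imp_iff, implies_true, and_true]
  refine ⟨?_, ?_, ?_, ?_, ?_⟩ <;> refine not_isNonposInt_of_re_pos ?_ <;> norm_num <;> linarith

theorem catalan_families : ∃ r : ℝ,
    HasSum (fun t : ℕ => catTerm n t) r ∧ HasSum (fun t : ℕ => catTerm' n (t + 1)) r := by
  have := n.cast_nonneg (α := ℝ)
  have hL := not_isNonposInt_of_mem_lowerL n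
  obtain ⟨s, sumR, limL⟩ := hypergeometric_transformation hL (not_isNonposInt_of_mem_lowerR n)
    (not_isNonposInt_of_re_pos (by norm_num; linarith))
    (.inl ⟨by norm_num; linarith, by norm_num; linarith⟩)
  have summable := summable_hypTerm_L hL (by norm_num; linarith)
  have sumL := (summable.hasSum_iff_tendsto_nat.mpr limL).mul_left (catScale n)
  simp only [← catTerm_add_eq, ← mul_assoc, catScale_mul_gammaFactor] at sumL
  have sumR := sumR.mul_left (catScale' n)
  simp only [← catTerm'_add_eq] at sumR
  exact ⟨_, hasSum_re_of_hasSum_ofReal_add (fun _ => catTerm_eq_zero) sumL,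
    hasSum_re_of_hasSum_ofReal_add (f := fun t => catTerm' n (t + 1))
      (fun _ => catTerm'_eq_zero) sumR⟩

end Catalan

end

theorem mainTheorem2 :
    (∀ n c d : ℂ,
      -- the lower parameters of both series are admissible, and so is `Γ(4n+3-c-d)`
      (∀ b ∈ lowerL n c d, ¬ IsNonposInt b) →
      (∀ b ∈ lowerR n c d, ¬ IsNonposInt b) →
      ¬ IsNonposInt (4 * n + 3 - c - d) →
      -- both series converge at the points `-1` and `1` of the unit circle, or both terminate
      ((0 < (5 * n + 4 - 2 * c - 2 * d).re ∧ 0 < (3 * n + 2 - c - d).re) ∨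
        IsNonposInt c ∨ IsNonposInt d) →
      ∃ s : ℂ, HasHypSum (upperR n c d) (lowerR n c d) 1 s ∧
        HasHypSum (upperL n c d) (lowerL n c d) (-1)
          (Complex.Gamma (4 * n + 3) * Complex.Gamma (3 * n + 2 - c) *
              Complex.Gamma (3 * n + 2 - d) * Complex.Gamma (4 * n + 3 - c - d) /
            (Complex.Gamma (3 * n + 2) * Complex.Gamma (4 * n + 3 - c) *
              Complex.Gamma (4 * n + 3 - d) * Complex.Gamma (3 * n + 2 - c - d)) * s)) ∧
    (∀ n : ℕ, ∃ r : ℝ,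
      HasSum (fun t : ℕ => catTerm n t) r ∧ HasSum (fun t : ℕ => catTerm' n (t + 1)) r) := by
  refine ⟨fun n c d hL hR hcd h => ?_, catalan_families⟩
  obtain ⟨s, sumR, limL⟩ := hypergeometric_transformation hL hR hcd h
  exact ⟨s, sumR.tendsto_sum_nat, limL⟩
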